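/- Consider the game of Cops and Robber on a finite connected simple graph $G$ with $k$ cops: the cops choose their start vertices (several may share one), then the robber chooses a vertex, and then the two sides alternate, the cops first; in a move every piece of the side stays where it is or moves along one edge; the cops win if some cop ever stands on the robber's vertex. $G$ is $k$-copwin if $k$ cops can force a win. The problem Cops and Robber asks, given a finite connected simple graph $G$ and $k\in\mathbb N$, whether $G$ is $k$-copwin. The cluster vertex deletion number $\mathsf{cvd}(G)$ is the least size of a set $U\subseteq V(G)$ such that $G-U$ is a disjoint union of cliques, and the deletion-to-stars number $\mathsf{dts}(G)$ is the least size of a set $U\subseteq V(G)$ such that $G-U$ is a disjoint union of stars $K_{1,p}$, $p\ge 0$. **Theorem.** (1) Parameterized by $\mathsf{cvd}$, Cops and Robber has a kernel with at most $2^{2^{\mathsf{cvd}}+\sqrt{\mathsf{cvd}}}$ vertices: there is a polynomial-time algorithm that maps every instance $(G,k)$ to an instance $(G',k')$ of the same problem such that $G'$ is $k'$-copwin if and only if $G$ is $k$-copwin, $|V(G')|\le 2^{2^{\mathsf{cvd}(G)}+\sqrt{\mathsf{cvd}(G)}}$, and $k'\le |V(G')|$. (2) Parameterized by $\mathsf{dts}$,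 Cops and Robber has a kernel with at most $2^{2^{\mathsf{dts}}+\mathsf{dts}^{1.5}}$ vertices: there is a polynomial-time algorithm that maps every instance $(G,k)$ to an instance $(G',k')$ of the same problem such that $G'$ is $k'$-copwin if and only if $G$ is $k$-copwin, $|V(G')|\le 2^{2^{\mathsf{dts}(G)}+\mathsf{dts}(G)^{1.5}}$, and $k'\le |V(G')|$. -/

import Mathlib

namespace CnR

/-! ### The game of Cops and Robber -/

/-- A single piece on `x` may stay where it is or move along one edge. -/
def Step {V : Type*} (G : SimpleGraph V) (x y : V) : Prop :=
  y = x ∨ G.Adj x y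

/-- `CopsWin G c r`: the cops are to move, they stand on the vertices `c i`, the robber stands
on `r`, and the cops can force a capture.  This is the least relation that contains all positions
in which the robber is caught and all positions in which the cops have a joint move `c'` that
either catches the robber or leads to a winning position whatever the robber answers. -/
inductive CopsWin {V : Type*} (G : SimpleGraph V) {k : ℕ} : (Fin k → V) → V → Prop
  | caught (c : Fin k → V) (r : V) (i : Fin k) (h : c i = r) : CopsWin G c r
  | move (c : Fin k → V) (r : V) (c' : Fin k → V)
      (legal : ∀ i, Step G (c i) (c' i))
      (next : (∀ i, c' i ≠ r) → ∀ r', Step G r r' → CopsWin G c' r') : CopsWin G c r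

/-- `G` is `k`-copwin: `k` cops can be placed such that they can force a capture wherever
the robber starts. -/
def IsCopwin {V : Type*} (G : SimpleGraph V) (k : ℕ) : Prop :=
  ∃ c : Fin k → V, ∀ r : V, CopsWin G c r

/-! ### The two graph parameters -/

/-- `H` is a disjoint union of cliques. -/
def IsClusterGraph {V : Type*} (H : SimpleGraph V) : Prop :=
  ∀ C : H.ConnectedComponent, H.IsClique C.supp

/-- `H` is a disjoint union of stars `K_{1,p}` with `p ≥ 0`: in every component two vertices are
adjacent if and only if they are distinct and one of them is the centre. -/
def IsStarForest {V : Type*} (H : SimpleGraph V) : Prop :=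
  ∀ C : H.ConnectedComponent, ∃ z ∈ C.supp, ∀ u ∈ C.supp, ∀ v ∈ C.supp,
    (H.Adj u v ↔ u ≠ v ∧ (u = z ∨ v = z))

/-- `G` with the vertices of `U` deleted. -/
abbrev deleteSet {V : Type*} (G : SimpleGraph V) (U : Finset V) :
    SimpleGraph {v : V // v ∉ U} :=
  G.comap (fun v => v.1)

/-- The cluster vertex deletion number. -/
noncomputable def cvd {V : Type*} (G : SimpleGraph V) : ℕ :=
  sInf {t | ∃ U : Finset V, U.card = t ∧ IsClusterGraph (deleteSet G U)}

/-- The deletion to stars number. -/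
noncomputable def dts {V : Type*} (G : SimpleGraph V) : ℕ :=
  sInf {t | ∃ U : Finset V, U.card = t ∧ IsStarForest (deleteSet G U)}

/-! ### Random access machines with a step count

Structured programs over natural-number variables and arrays, with the arithmetic operations
`+` and (truncated) `-` at unit cost.  A program mentions only finitely many variables and
arrays.  The output is written bit by bit. -/

/-- Expressions: constants, variables, array cells `A[e]`, sums, truncated differences. -/
inductive Expr : Type
  | const (m : ℕ)
  | var (x : ℕ)
  | cell (a : ℕ) (e : Expr)
  | add (e₁ e₂ : Expr)
  | sub (e₁ e₂ : Expr)

/-- Programs.  Every value different from `0` counts as true. -/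
inductive Prog : Type
  | skip
  | assign (x : ℕ) (e : Expr)
  | store (a : ℕ) (i e : Expr)
  | emit (e : Expr)
  | seq (p q : Prog)
  | ite (e : Expr) (p q : Prog)
  | loop (e : Expr) (p : Prog)

/-- The contents of the variables, of the arrays, and of the write-only output tape. -/
structure State where
  var : ℕ → ℕ
  arr : ℕ → ℕ → ℕ
  out : List Bool

/-- The value of an expression. -/
def Expr.eval (s : State) : Expr → ℕ
  | .const m => m
  | .var x => s.var x
  | .cell a e => s.arr a (e.eval s)
  | .add e₁ e₂ => e₁.eval s + e₂.eval s
  | .sub e₁ e₂ => e₁.eval s - e₂.eval s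

/-- The number of operations needed to evaluate an expression. -/
def Expr.cost : Expr → ℕ
  | .const _ => 1
  | .var _ => 1
  | .cell _ e => e.cost + 1
  | .add e₁ e₂ => e₁.cost + e₂.cost + 1
  | .sub e₁ e₂ => e₁.cost + e₂.cost + 1

/-- `Runs p s s' t`: started in the state `s`, the program `p` halts in the state `s'`
after exactly `t` steps. -/
inductive Runs : Prog → State → State → ℕ → Prop
  | skip (s : State) : Runs .skip s s 1
  | assign (s : State) (x : ℕ) (e : Expr) :
      Runs (.assign x e) s { s with var := Function.update s.var x (e.eval s) } (e.cost + 1)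
  | store (s : State) (a : ℕ) (i e : Expr) :
      Runs (.store a i e) s
        { s with arr := Function.update s.arr a
                          (Function.update (s.arr a) (i.eval s) (e.eval s)) }
        (i.cost + e.cost + 1)
  | emit (s : State) (e : Expr) :
      Runs (.emit e) s { s with out := s.out ++ [decide (e.eval s ≠ 0)] } (e.cost + 1)
  | seq {p q : Prog} {s s' s'' : State} {t t' : ℕ} (hp : Runs p s s' t) (hq : Runs q s' s'' t') :
      Runs (.seq p q) s s'' (t + t' + 1)
  | ite_true {e : Expr} {p q : Prog} {s s' : State} {t : ℕ} (he : e.eval s ≠ 0)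
      (hp : Runs p s s' t) : Runs (.ite e p q) s s' (e.cost + t + 1)
  | ite_false {e : Expr} {p q : Prog} {s s' : State} {t : ℕ} (he : e.eval s = 0)
      (hq : Runs q s s' t) : Runs (.ite e p q) s s' (e.cost + t + 1)
  | loop_done {e : Expr} {p : Prog} {s : State} (he : e.eval s = 0) :
      Runs (.loop e p) s s (e.cost + 1)
  | loop_again {e : Expr} {p : Prog} {s s' s'' : State} {t t' : ℕ} (he : e.eval s ≠ 0)
      (hp : Runs p s s' t) (hl : Runs (.loop e p) s' s'' t') :
      Runs (.loop e p) s s'' (e.cost + t + t' + 1)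

/-- The initial state on the input word `w`: variable `0` holds the length of `w`, array `0`
holds the bits of `w`, everything else is `0`, and nothing has been written. -/
def initState (w : List Bool) : State where
  var := fun x => if x = 0 then w.length else 0
  arr := fun a i => if a = 0 then (w.getD i false).toNat else 0
  out := []

/-- The map `f` is computable in time polynomial in the length of the (encoded) input. -/
def PolyTimeComputable {α β : Type*} (encα : α → List Bool) (encβ : β → List Bool)
    (f : α → β) : Prop :=
  ∃ (p : Prog) (T : Polynomial ℕ), ∀ a : α, ∃ (s : State) (t : ℕ),
    Runs p (initState (encα a)) s t ∧ t ≤ T.eval (encα a).length ∧ s.out = encβ (f a)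

/-! ### The decision problem and its kernels -/

/-- An instance of Cops and Robber: a finite connected simple graph and a number of cops. -/
structure Instance where
  n : ℕ
  graph : SimpleGraph (Fin n)
  connected : graph.Connected
  k : ℕ

/-- The yes-instances. -/
def Instance.IsYes (I : Instance) : Prop := IsCopwin I.graph I.k

open Classical in
/-- An instance as a word: the number of vertices in unary, a separator, the adjacency matrix
row by row, and `k` in binary (least significant bit first). -/
noncomputable def Instance.encode (I : Instance) : List Bool :=
  List.replicate I.n true ++ [false] ++
    (List.finRange I.n).flatMap
      (fun u => (List.finRange I.n).map (fun v => decide (I.graph.Adj u v))) ++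
    I.k.bits

/-- Cops and Robber, parameterized by `par`, has a kernel with at most `b t` vertices, where `t`
is the value of the parameter: a polynomial-time map from instances to equivalent instances whose
number of vertices is at most `b t`, and whose number of cops is not larger than its number of
vertices (so that the whole size of the output is bounded in terms of `t`). -/
def HasKernel (par : Instance → ℕ) (b : ℕ → ℝ) : Prop :=
  ∃ f : Instance → Instance,
    PolyTimeComputable Instance.encode Instance.encode f ∧
    ∀ I : Instance, ((f I).IsYes ↔ I.IsYes) ∧
      ((f I).n : ℝ) ≤ b (par I) ∧ (f I).k ≤ (f I).n

end CnR

/-!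
One polynomial-time reduction serves both parameters.  It maintains a set `S` of vertices that are
still alive, and for two vertices `a ≠ b` of `S` it tries to *fold* `a` onto `b`: the set
`A = {a} ∪ (N(a) \ N[b])` is deleted if a local condition (`Foldable`) guarantees that the identity
on `S \ A` extends to a retraction of `G[S]` onto `G[S \ A]` that sends `a` to `b` and the other
vertices of `A` to `N[b] \ N[a]` (`Foldable.exists_retraction`).  A retract of a `k`-copwin graph is
`k`-copwin (`IsCopwin.map_retraction`).  Conversely, if `k` cops win on the retract and `2 ≤ k`, then they can
make one cop shadow the image of the robber, which confines the robber to `A`; a second cop walks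
to `a`, and `A ⊆ N[a]`, so the robber is caught (`CopsWin.of_shadow_two`).  For a single cop
only dominated vertices are folded, and an irreducible graph is copwin if and only if it has
one vertex (`isCopwin_one_iff`).

Folds recognise the components of `G - U` without knowledge of `U`.  If two components of `G - U`
are cliques, or stars with centres `a` and `b`, such that the same traces on `U` occur in both, then
`A` and its image are exactly these components, for `a`, `b` with the same trace.  Hence
in an irreducible graph and for `2 ≤ k`, each type of component occurs once, and the traces on a
clique form an antichain, while the traces of the leaves of a star are distinct and nonempty.
Counting types (`CliquesOff.card_le`, `StarsOn.card_le`) gives the two bounds.  The optimal `U` for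
`G` may be used for the irreducible `G[S]` because both deletion properties are hereditary.

For the running time, the condition for a fold is written as a first-order formula with quantifiers
over vertices, and every such formula is compiled into a program that decides it in polynomial time
(`Fm.exec`).  The number of cops in the output is at most the number of vertices, since cops on all
vertices win.
-/

namespace CnR

theorem Step.refl {V : Type*} (G : SimpleGraph V) (x : V) : Step G x x := Or.inl rfl

theorem Step.symm {V : Type*} {G : SimpleGraph V} {x y : V} (h : Step G x y) : Step G y x :=
  h.elim (fun h => Or.inl h.symm) (fun h => Or.inr h.symm)

/-! ### Retracts and the game -/

section Retract

variable {V W : Type*} {G : SimpleGraph V} {H : SimpleGraph W} {k : ℕ} {ι : W → V} {φ : V → W}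

theorem CopsWin.map_retraction (hφι : ∀ w, φ (ι w) = w)
    (hι : ∀ x y, Step H x y → Step G (ι x) (ι y)) (hφ : ∀ x y, Step G x y → Step H (φ x) (φ y))
    {c : Fin k → V} {v : V} (h : CopsWin G c v) :
    ∀ r : W, ι r = v → CopsWin H (fun i => φ (c i)) r := by
  induction h with
  | caught c v i h =>
    rintro r rfl
    exact .caught _ _ i (by simp only [h, hφι])
  | move c v c' legal next ih =>
    rintro r rfl
    refine .move _ _ (fun i => φ (c' i)) (fun i => hφ _ _ (legal i)) fun hne r' hr' => ?_
    refine ih (fun i hi => hne i ?_) (ι r') (hι _ _ hr') r' rfl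
    simp only [hi, hφι]

/-- A retract of a `k`-copwin graph is `k`-copwin: the cops play the images of their moves. -/
theorem IsCopwin.map_retraction (hφι : ∀ w, φ (ι w) = w)
    (hι : ∀ x y, Step H x y → Step G (ι x) (ι y)) (hφ : ∀ x y, Step G x y → Step H (φ x) (φ y))
    (h : IsCopwin G k) : IsCopwin H k := by
  obtain ⟨c, hc⟩ := h
  exact ⟨fun i => φ (c i), fun r => (hc (ι r)).map_retraction hφι hι hφ r rfl⟩

theorem CopsWin.lift_retraction
    (hι : ∀ x y, Step H x y → Step G (ι x) (ι y)) (hφ : ∀ x y, Step G x y → Step H (φ x) (φ y))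
    (shadow : ∀ (c : Fin k → V) (r : V), (∃ i, Step G (c i) (ι (φ r))) → CopsWin G c r)
    {c : Fin k → W} {w : W} (h : CopsWin H c w) :
    ∀ r : V, φ r = w → CopsWin G (fun i => ι (c i)) r := by
  induction h with
  | caught c w i h =>
    rintro r rfl
    exact shadow _ _ ⟨i, Or.inl (by rw [h])⟩
  | move c w c' legal next ih =>
    rintro r rfl
    refine .move _ _ (fun i => ι (c' i)) (fun i => hι _ _ (legal i)) fun _ r' hr' => ?_
    by_cases hc : ∃ i, c' i = φ r
    · obtain ⟨i, hi⟩ := hc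
      exact shadow _ _ ⟨i, by simpa only [hi] using hι _ _ (hφ _ _ hr')⟩
    · push Not at hc
      exact ih hc _ (hφ _ _ hr') r' rfl

/-- If the cops win on a retract, and win on the whole graph as soon as one of them can step onto
the image of the robber, then they win on the whole graph. -/
theorem IsCopwin.lift_retraction
    (hι : ∀ x y, Step H x y → Step G (ι x) (ι y)) (hφ : ∀ x y, Step G x y → Step H (φ x) (φ y))
    (shadow : ∀ (c : Fin k → V) (r : V), (∃ i, Step G (c i) (ι (φ r))) → CopsWin G c r)
    (h : IsCopwin H k) : IsCopwin G k := by
  obtain ⟨c, hc⟩ := h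
  exact ⟨fun i => ι (c i), fun r => (hc (φ r)).lift_retraction hι hφ shadow r rfl⟩

end Retract

/-! ### Shadowing the image of the robber -/

section Shadow

variable {V : Type*} {G : SimpleGraph V} {k : ℕ} {ρ : V → V}

theorem CopsWin.of_step {c : Fin k → V} {r : V} (i : Fin k) (h : Step G (c i) r) :
    CopsWin G c r := by
  refine .move _ _ (Function.update c i r) (fun j => ?_) fun hne => absurd ?_ (hne i)
  · by_cases hj : j = i
    · subst hj; simpa using h
    · simpa [hj] using Step.refl G (c j)
  · simp

/-- A cop that shadows the image of the robber under a retraction confines the robber to the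
vertices moved by the retraction.  When all of these lie in the closed neighbourhood of `a`, a
second cop finishes by walking to `a`. -/
theorem CopsWin.of_shadow_two (hk : 2 ≤ k) (hG : G.Preconnected)
    (hρ : ∀ x y, Step G x y → Step G (ρ x) (ρ y))
    {a : V} (ha : ∀ v, ρ v ≠ v → Step G a v) (c : Fin k → V) (r : V)
    (h : ∃ i, Step G (c i) (ρ r)) : CopsWin G c r := by
  obtain ⟨i, hi⟩ := h
  have : Nontrivial (Fin k) := Fin.nontrivial_iff_two_le.2 hk
  obtain ⟨j, hj⟩ := exists_ne i
  obtain ⟨p⟩ := hG (c j) a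
  suffices H : ∀ (v w : V) (p : G.Walk v w), w = a → ∀ (c : Fin k → V) (r : V),
      Step G (c i) (ρ r) → c j = v → CopsWin G c r from H _ _ p rfl c r hi rfl
  intro v w p
  induction p with
  | nil =>
    rintro rfl c r hi hj
    by_cases hr : ρ r = r
    · exact .of_step i (hr ▸ hi)
    · exact .of_step j (hj ▸ ha r hr)
  | @cons v v' w hadj p ih =>
    rintro rfl c r hi hjv
    refine .move _ _ (Function.update (Function.update c i (ρ r)) j v') (fun l => ?_)
      fun _ r' hr' => ih rfl _ _ ?_ (by simp)
    · by_cases hl : l = j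
      · subst hl
        rw [Function.update_self, hjv]
        exact Or.inr hadj
      · by_cases hl' : l = i
        · subst hl'; simpa [hl] using hi
        · simpa [hl, hl'] using Step.refl G (c l)
    · simpa [hj.symm] using hρ _ _ hr'

/-- When only `a` is moved and its image dominates it, a single shadowing cop suffices. -/
theorem CopsWin.of_shadow_corner {a : V} (ha : ∀ v, ρ v ≠ v → v = a)
    (hdom : ∀ v, Step G a v → Step G (ρ a) v) (c : Fin k → V) (r : V)
    (h : ∃ i, Step G (c i) (ρ r)) : CopsWin G c r := by
  obtain ⟨i, hi⟩ := h
  by_cases hr : ρ r = r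
  · exact .of_step i (hr ▸ hi)
  · obtain rfl := ha r hr
    refine .move _ _ (Function.update c i (ρ r)) (fun l => ?_) fun _ r' hr' =>
      .of_step i (by simpa using hdom _ hr')
    by_cases hl : l = i
    · subst hl; simpa using hi
    · simpa [hl] using Step.refl G (c l)

end Shadow

/-! ### Very few and very many cops -/

section FewCops

variable {V : Type*} {G : SimpleGraph V}

theorem not_isCopwin_zero [Nonempty V] : ¬ IsCopwin G 0 := by
  have key : ∀ (c : Fin 0 → V) (r : V), ¬ CopsWin G c r := by
    intro c r h
    induction h with
    | caught c r i => exact i.elim0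
    | move c r c' _ _ ih => exact ih (fun i => i.elim0) r (Step.refl G r)
  rintro ⟨c, hc⟩
  obtain ⟨r⟩ := ‹Nonempty V›
  exact key c r (hc r)

/-- Enough cops occupy all vertices. -/
theorem isCopwin_of_card_le [Fintype V] [Nonempty V] {k : ℕ} (h : Fintype.card V ≤ k) :
    IsCopwin G k := by
  obtain ⟨f⟩ : Nonempty (V ↪ Fin k) := Function.Embedding.nonempty_of_card_le (by simpa using h)
  refine ⟨Function.invFun f, fun r => .caught _ _ (f r) ?_⟩
  exact Function.leftInverse_invFun f.injective r

theorem CopsWin.exists_step (hG : ∀ a b : V, a ≠ b → ∃ x, Step G a x ∧ ¬ Step G b x)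
    {c : Fin 1 → V} {r : V} (h : CopsWin G c r) : Step G (c 0) r := by
  induction h with
  | caught c r i h => rw [Subsingleton.elim 0 i]; exact Or.inl h.symm
  | move c r c' legal _ ih =>
    by_contra hr
    have hne : c' 0 ≠ r := fun h => hr (h ▸ legal 0)
    obtain ⟨x, hx, hx'⟩ := hG r (c' 0) hne.symm
    exact hx' (ih (fun i => by rwa [Subsingleton.elim i 0]) x hx)

/-- One cop loses on a graph with at least two vertices in which no closed neighbourhood
contains another one. -/
theorem not_isCopwin_one [Nontrivial V]
    (hG : ∀ a b : V, a ≠ b → ∃ x, Step G a x ∧ ¬ Step G b x) : ¬ IsCopwin G 1 := by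
  rintro ⟨c, hc⟩
  obtain ⟨a, ha⟩ := exists_ne (c 0)
  obtain ⟨x, -, hx⟩ := hG a (c 0) ha
  exact hx ((hc x).exists_step hG)

end FewCops

/-! ### Folding a vertex together with its private neighbours -/

section Fold

variable {V : Type*} {G : SimpleGraph V}

/-- `G[S]`, for a finite vertex set `S`. -/
abbrev sub {V : Type*} (G : SimpleGraph V) (S : Finset V) : SimpleGraph S :=
  G.comap (fun v => v.1)

/-- `x` is a neighbour of `a` outside the closed neighbourhood of `b`. -/
def Priv (G : SimpleGraph V) (a b x : V) : Prop := G.Adj a x ∧ ¬ Step G b x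

/-- Membership in the set deleted when `a` is folded onto `b`: `a` and its private neighbours. -/
def Del (G : SimpleGraph V) (a b x : V) : Prop := x = a ∨ Priv G a b x

/-- `x` is a possible image when `a` is folded onto `b`: it lies in the closed neighbourhood
of `b` and outside that of `a`. -/
def Img (G : SimpleGraph V) (a b x : V) : Prop := Step G b x ∧ ¬ Step G a x

/-- In `G[S]` the vertex `a` is dominated by `b`. -/
def Corner (G : SimpleGraph V) (S : Finset V) (a b : V) : Prop :=
  ∀ x ∈ S, Step G a x → Step G b x

/-- In `G[S]` the vertex `a` together with its private neighbours can be folded onto `b` and its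
private neighbours: every deleted neighbour of `a` has an image that sees all the vertices
it sees outside the deleted set, and edges between deleted neighbours are harmless, because there
are none or because all possible images are pairwise adjacent. -/
def Foldable (G : SimpleGraph V) (S : Finset V) (a b : V) : Prop :=
  (∀ x ∈ S, Priv G a b x → ∃ y ∈ S, Img G a b y ∧
    ∀ w ∈ S, G.Adj x w → ¬ Del G a b w → Step G y w) ∧
  ((∀ x ∈ S, Priv G a b x → ∀ y ∈ S, Priv G a b y → ¬ G.Adj x y) ∨
    ∀ x ∈ S, Img G a b x → ∀ y ∈ S, Img G a b y → Step G x y)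

/-- The reduction applies to the pair `a`, `b` in `G[S]` for `k` cops.  With at most one cop only
dominated vertices may be deleted. -/
def Reducible (k : ℕ) (G : SimpleGraph V) (S : Finset V) (a b : V) : Prop :=
  a ∈ S ∧ b ∈ S ∧ a ≠ b ∧ if k ≤ 1 then Corner G S a b else Foldable G S a b

open Classical in
/-- The vertices that remain after `a` has been folded onto `b`. -/
noncomputable def fold (G : SimpleGraph V) (S : Finset V) (a b : V) : Finset V :=
  S.filter fun x => ¬ Del G a b x

theorem mem_fold {S : Finset V} {a b x : V} : x ∈ fold G S a b ↔ x ∈ S ∧ ¬ Del G a b x := by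
  simp [fold]

theorem fold_subset (S : Finset V) (a b : V) : fold G S a b ⊆ S :=
  fun _ hx => (mem_fold.1 hx).1

theorem fold_ssubset {S : Finset V} {a b : V} (ha : a ∈ S) : fold G S a b ⊂ S :=
  (Finset.ssubset_iff_of_subset (fold_subset S a b)).2
    ⟨a, ha, fun h => (mem_fold.1 h).2 (Or.inl rfl)⟩

theorem Corner.not_priv {S : Finset V} {a b x : V} (h : Corner G S a b) (hx : x ∈ S) :
    ¬ Priv G a b x := fun hp => hp.2 (h x hx (Or.inr hp.1))

theorem Corner.foldable {S : Finset V} {a b : V} (h : Corner G S a b) : Foldable G S a b :=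
  ⟨fun _ hx hp => absurd hp (h.not_priv hx), Or.inl fun _ hx hp => absurd hp (h.not_priv hx)⟩

theorem step_sub_iff {T : Finset V} {x y : T} : Step (sub G T) x y ↔ Step G x.1 y.1 :=
  or_congr Subtype.ext_iff Iff.rfl

/-- The fold is a retraction of `G[S]` onto the remaining vertices. -/
theorem Foldable.exists_retraction {S : Finset V} {a b : V} (hb : b ∈ S)
    (hab : a ≠ b) (h : Foldable G S a b) :
    ∃ φ : S → fold G S a b, (∀ v : S, ¬ Del G a b v → (φ v).1 = v.1) ∧
      (∀ v : S, v.1 = a → (φ v).1 = b) ∧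
      ∀ x y, Step (sub G S) x y → Step (sub G (fold G S a b)) (φ x) (φ y) := by
  classical
  choose f hfS hf hfw using h.1
  have hb' : b ∈ fold G S a b := mem_fold.2 ⟨hb, by
    rintro (rfl | hp)
    · exact hab rfl
    · exact hp.2 (Step.refl G _)⟩
  have hf' : ∀ x hx hp, f x hx hp ∈ fold G S a b := fun x hx hp => mem_fold.2 ⟨hfS x hx hp, by
    rintro (hp' | hp')
    · exact (hf x hx hp).2 (Or.inl hp')
    · exact hp'.2 (hf x hx hp).1⟩
  let φ : S → fold G S a b := fun v =>
    if hp : Priv G a b v then ⟨f v v.2 hp, hf' _ _ _⟩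
    else if hv : v.1 = a then ⟨b, hb'⟩ else ⟨v, mem_fold.2 ⟨v.2, fun h => h.elim hv hp⟩⟩
  have φp : ∀ v : S, ∀ hp : Priv G a b v, (φ v).1 = f v v.2 hp := fun v hp => by simp [φ, hp]
  have φa : ∀ v : S, v.1 = a → (φ v).1 = b := by
    intro v hv
    have hp : ¬ Priv G a b v := fun hp => hp.1.ne hv.symm
    simp only [φ, dif_neg hp, dif_pos hv]
  have φn : ∀ v : S, ¬ Del G a b v → (φ v).1 = v.1 := by
    intro v hv
    have hp : ¬ Priv G a b v := fun hp => hv (Or.inr hp)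
    have ha : v.1 ≠ a := fun ha => hv (Or.inl ha)
    simp [φ, hp, ha]
  refine ⟨φ, φn, φa, ?_⟩
  -- Edges at `a`, and edges that leave the deleted set at a neighbour of `a`.
  have of_a : ∀ x y : S, x.1 = a → G.Adj x y → Step G (φ x).1 (φ y).1 := by
    intro x y hx hxy
    rw [φa x hx]
    by_cases hp : Priv G a b y
    · rw [φp y hp]; exact (hf _ _ hp).1
    · have hy : ¬ Del G a b y := fun h => h.elim (fun h => hxy.ne (hx.trans h.symm)) hp
      rw [φn y hy]
      by_contra hs
      exact hp ⟨hx ▸ hxy, hs⟩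
  have of_p : ∀ x y : S, Priv G a b x → ¬ Del G a b y → G.Adj x y →
      Step G (φ x).1 (φ y).1 := by
    intro x y hx hy hxy
    rw [φp x hx, φn y hy]
    exact hfw _ _ _ _ y.2 hxy hy
  intro x y hxy
  rw [step_sub_iff] at hxy ⊢
  rcases hxy with hxy | hxy
  · rw [Subtype.ext hxy]; exact Step.refl G _
  by_cases hx : x.1 = a
  · exact of_a x y hx hxy
  by_cases hy : y.1 = a
  · exact (of_a y x hy hxy.symm).symm
  by_cases hpx : Priv G a b x <;> by_cases hpy : Priv G a b y
  · rw [φp x hpx, φp y hpy]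
    rcases h.2 with h2 | h2
    · exact absurd hxy (h2 _ x.2 hpx _ y.2 hpy)
    · exact h2 _ (hfS _ _ _) (hf _ _ _) _ (hfS _ _ _) (hf _ _ _)
  · exact of_p x y hpx (fun h => h.elim hy hpy) hxy
  · exact (of_p y x hpy (fun h => h.elim hx hpx) hxy.symm).symm
  · rw [φn x fun h => h.elim hx hpx, φn y fun h => h.elim hy hpy]
    exact Or.inr hxy

theorem Reducible.foldable {k : ℕ} {S : Finset V} {a b : V} (h : Reducible k G S a b) :
    Foldable G S a b := by
  have := h.2.2.2
  split_ifs at this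
  · exact this.foldable
  · exact this

/-- Step-preserving surjections preserve connectedness. -/
theorem Preconnected.map_step {V W : Type*} {G : SimpleGraph V} {H : SimpleGraph W} {φ : V → W}
    (hs : Function.Surjective φ) (hφ : ∀ x y, Step G x y → Step H (φ x) (φ y))
    (hG : G.Preconnected) : H.Preconnected := by
  intro u v
  obtain ⟨x, rfl⟩ := hs u
  obtain ⟨y, rfl⟩ := hs v
  obtain ⟨p⟩ := hG x y
  induction p with
  | nil => exact .refl _
  | cons hadj p ih =>
    refine SimpleGraph.Reachable.trans ?_ ih
    rcases hφ _ _ (Or.inr hadj) with h | h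
    · rw [h]
    · exact h.reachable

theorem Reducible.connected_fold {k : ℕ} {S : Finset V} {a b : V} (h : Reducible k G S a b)
    (hS : (sub G S).Connected) : (sub G (fold G S a b)).Connected := by
  obtain ⟨φ, h1, h2, h3⟩ := h.foldable.exists_retraction h.2.1 h.2.2.1
  have hs : Function.Surjective φ := fun w => ⟨⟨w, (mem_fold.1 w.2).1⟩, Subtype.ext
    (h1 _ (mem_fold.1 w.2).2)⟩
  have : Nonempty (fold G S a b) := ⟨φ ⟨a, h.1⟩⟩
  exact ⟨Preconnected.map_step hs h3 hS.preconnected⟩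

theorem Reducible.isCopwin_fold {k : ℕ} {S : Finset V} {a b : V} (h : Reducible k G S a b)
    (hS : (sub G S).Connected) :
    IsCopwin (sub G (fold G S a b)) k ↔ IsCopwin (sub G S) k := by
  obtain ⟨φ, h1, h2, h3⟩ := h.foldable.exists_retraction h.2.1 h.2.2.1
  let ι : fold G S a b → S := fun w => ⟨w, (mem_fold.1 w.2).1⟩
  have hφι : ∀ w, φ (ι w) = w := fun w => Subtype.ext (h1 _ (mem_fold.1 w.2).2)
  have hι : ∀ x y, Step (sub G (fold G S a b)) x y → Step (sub G S) (ι x) (ι y) := by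
    intro x y hxy
    rw [step_sub_iff] at hxy ⊢
    exact hxy
  have hdel : ∀ v : S, ι (φ v) ≠ v → Del G a b v := fun v hv => by
    by_contra hd
    exact hv (Subtype.ext (h1 v hd))
  refine ⟨IsCopwin.lift_retraction hι h3 ?_, IsCopwin.map_retraction hφι hι h3⟩
  by_cases hk : k ≤ 1
  · have hc : Corner G S a b := by have := h.2.2.2; rwa [if_pos hk] at this
    refine CopsWin.of_shadow_corner (a := ⟨a, h.1⟩) (fun v hv => ?_) fun v hv => ?_
    · exact (hdel v hv).elim (fun h => Subtype.ext h) fun hp => absurd hp (hc.not_priv v.2)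
    · rw [step_sub_iff] at hv ⊢
      have := h2 ⟨a, h.1⟩ rfl
      simp only [ι, this]
      exact hc v v.2 hv
  · refine CopsWin.of_shadow_two (ρ := fun v => ι (φ v)) (by omega) hS.preconnected
      (fun x y hxy => hι _ _ (h3 _ _ hxy)) (a := ⟨a, h.1⟩) fun v hv => ?_
    rw [step_sub_iff]
    exact (hdel v hv).imp id fun hp => hp.1

end Fold

/-! ### Exhaustive reduction -/

section Sweep

variable {n : ℕ} {G : SimpleGraph (Fin n)} {k : ℕ}

open Classical in
/-- One attempt to reduce. -/
noncomputable def attempt (k : ℕ) (G : SimpleGraph (Fin n)) (S : Finset (Fin n))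
    (a b : Fin n) : Finset (Fin n) :=
  if Reducible k G S a b then fold G S a b else S

/-- The attempts for all pairs, one after the other. -/
noncomputable def sweep (k : ℕ) (G : SimpleGraph (Fin n)) (S : Finset (Fin n)) :
    Finset (Fin n) :=
  (List.finRange n).foldl (fun S a => (List.finRange n).foldl (fun S b => attempt k G S a b) S) S

/-- The vertices that survive `n` sweeps. -/
noncomputable def core (k : ℕ) (G : SimpleGraph (Fin n)) : Finset (Fin n) :=
  (sweep k G)^[n] Finset.univ

theorem foldl_induction {α β : Type*} (P : β → Prop) (f : β → α → β)
    (h : ∀ b a, P b → P (f b a)) (l : List α) {b : β} (hb : P b) : P (l.foldl f b) := by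
  induction l generalizing b with
  | nil => exact hb
  | cons a l ih => exact ih (h _ _ hb)

/-- A fold of operations that only delete, with at least one effective operation for the initial
set, ends in a smaller set. -/
theorem foldl_subset_or {α β : Type*} (f : Finset β → α → Finset β) (h : ∀ S a, f S a ⊆ S)
    (l : List α) (S : Finset β) : l.foldl f S ⊂ S ∨ (l.foldl f S = S ∧ ∀ a ∈ l, f S a = S) := by
  induction l generalizing S with
  | nil => exact Or.inr ⟨rfl, by simp⟩
  | cons a l ih =>
    have hsub : ∀ T, l.foldl f T ⊆ T := fun T =>
      (ih T).elim (fun h => h.subset) (fun h => h.1.subset)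
    rcases (h S a).eq_or_ssubset with ha | ha
    · rcases ih S with h' | ⟨h1, h2⟩
      · exact Or.inl (by rwa [List.foldl_cons, ha])
      · refine Or.inr ⟨by rwa [List.foldl_cons, ha], ?_⟩
        simpa [ha] using h2
    · exact Or.inl ((hsub _).trans_ssubset ha)

theorem attempt_subset (S : Finset (Fin n)) (a b : Fin n) : attempt k G S a b ⊆ S := by
  unfold attempt
  split_ifs
  · exact fold_subset S a b
  · exact subset_rfl

theorem not_reducible_of_attempt_eq {S : Finset (Fin n)} {a b : Fin n}
    (h : attempt k G S a b = S) : ¬ Reducible k G S a b := fun hr => by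
  rw [attempt, if_pos hr] at h
  exact (fold_ssubset hr.1).ne h

theorem sweep_ssubset_or (S : Finset (Fin n)) :
    sweep k G S ⊂ S ∨ (sweep k G S = S ∧ ∀ a b, ¬ Reducible k G S a b) := by
  have inner := fun (a : Fin n) (S : Finset (Fin n)) =>
    foldl_subset_or (fun S b => attempt k G S a b) (fun S b => attempt_subset S a b)
      (List.finRange n) S
  have hsub := fun (S : Finset (Fin n)) (a : Fin n) =>
    (inner a S).elim (fun h => h.subset) (fun h => h.1.subset)
  refine (foldl_subset_or _ hsub (List.finRange n) S).imp id fun h => ⟨h.1, fun a b => ?_⟩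
  have ha := h.2 a (List.mem_finRange a)
  have hb := (inner a S).resolve_left fun h' => h'.ne ha
  exact not_reducible_of_attempt_eq (hb.2 b (List.mem_finRange b))

theorem not_reducible_core (a b : Fin n) : ¬ Reducible k G (core k G) a b := by
  have key : ∀ i, ((sweep k G)^[i] Finset.univ).card + i ≤ n ∨
      sweep k G ((sweep k G)^[i] Finset.univ) = (sweep k G)^[i] Finset.univ := by
    intro i
    induction i with
    | zero => left; simp
    | succ i ih =>
      rw [Function.iterate_succ_apply']
      rcases ih with ih | ih
      · rcases sweep_ssubset_or (k := k) (G := G) ((sweep k G)^[i] Finset.univ) with h | h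
        · left
          have := Finset.card_lt_card h
          omega
        · right; rw [h.1, h.1]
      · right; rw [ih, ih]
  have hfix : sweep k G (core k G) = core k G := by
    rcases key n with h | h
    · have : core k G = ∅ := Finset.card_eq_zero.1 (by unfold core; omega)
      rcases sweep_ssubset_or (k := k) (G := G) (core k G) with h' | h'
      · rw [this] at h'; exact absurd h' (Finset.not_ssubset_empty _)
      · exact h'.1
    · exact h
  exact ((sweep_ssubset_or _).resolve_left fun h => h.ne hfix).2 a b

/-- The reduction keeps the graph connected and the answer unchanged. -/
theorem core_spec (hG : G.Connected) :
    (sub G (core k G)).Connected ∧ (IsCopwin (sub G (core k G)) k ↔ IsCopwin G k) := by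
  let P : Finset (Fin n) → Prop := fun S =>
    (sub G S).Connected ∧ (IsCopwin (sub G S) k ↔ IsCopwin G k)
  have hatt : ∀ a S b, P S → P (attempt k G S a b) := by
    intro a S b hS
    unfold attempt
    split_ifs with h
    · exact ⟨h.connected_fold hS.1, (h.isCopwin_fold hS.1).trans hS.2⟩
    · exact hS
  have hsweep : ∀ S, P S → P (sweep k G S) := fun S hS =>
    foldl_induction P _ (fun S a hS => foldl_induction P _ (hatt a) _ hS) _ hS
  have huniv : P Finset.univ := by
    let ι : Fin n → (Finset.univ : Finset (Fin n)) := fun v => ⟨v, Finset.mem_univ v⟩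
    have hι : ∀ x y, Step G x y → Step (sub G Finset.univ) (ι x) (ι y) := fun x y h =>
      step_sub_iff.2 h
    have hφ : ∀ x y : (Finset.univ : Finset (Fin n)), Step (sub G Finset.univ) x y →
        Step G x.1 y.1 := fun x y h => step_sub_iff.1 h
    have := hG.nonempty
    refine ⟨?_, ?_⟩
    · have : Nonempty (Finset.univ : Finset (Fin n)) := this.map ι
      exact ⟨Preconnected.map_step (φ := ι) (fun w => ⟨w.1, rfl⟩) hι hG.preconnected⟩
    · exact ⟨IsCopwin.map_retraction (ι := ι) (φ := fun v => v.1) (fun _ => rfl) hι hφ,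
        IsCopwin.map_retraction (ι := fun v => v.1) (φ := ι) (fun _ => rfl) hφ hι⟩
  have : ∀ i, P ((sweep k G)^[i] Finset.univ) := by
    intro i
    induction i with
    | zero => exact huniv
    | succ i ih => rw [Function.iterate_succ_apply']; exact hsweep _ ih
  exact this n

end Sweep

/-! ### Traces on a deletion set -/

section Types

variable {V : Type*} {G : SimpleGraph V} {S U : Finset V} {k : ℕ}

open Classical in
/-- The neighbours of `v` in `U`. -/
noncomputable def trace (G : SimpleGraph V) (U : Finset V) (v : V) : Finset V :=
  U.filter fun x => G.Adj v x

theorem mem_trace {v x : V} : x ∈ trace G U v ↔ x ∈ U ∧ G.Adj v x := by simp [trace]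

theorem trace_subset (v : V) : trace G U v ⊆ U := fun _ hx => (mem_trace.1 hx).1

theorem Corner.eq (hk : 2 ≤ k) (hS : ∀ a b, ¬ Reducible k G S a b) {a b : V} (ha : a ∈ S)
    (hb : b ∈ S) (h : Corner G S a b) : a = b := by
  by_contra hab
  exact hS a b ⟨ha, hb, hab, by rw [if_neg (by omega)]; exact h.foldable⟩

theorem Foldable.eq (hk : 2 ≤ k) (hS : ∀ a b, ¬ Reducible k G S a b) {a b : V} (ha : a ∈ S)
    (hb : b ∈ S) (h : Foldable G S a b) : a = b := by
  by_contra hab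
  exact hS a b ⟨ha, hb, hab, by rw [if_neg (by omega)]; exact h⟩

end Types

/-! ### Irreducible graphs near cluster graphs -/

section Cluster

variable {V : Type*} {G : SimpleGraph V} {S U : Finset V} {k : ℕ}

open Classical in
/-- The set of traces of the vertices in the clique of `v`. -/
noncomputable def cliqueType (G : SimpleGraph V) (S U : Finset V) (v : V) : Finset (Finset V) :=
  ((S.filter fun x => x ∉ U).filter fun x => Step G v x).image (trace G U)

theorem mem_cliqueType {v : V} {s : Finset V} :
    s ∈ cliqueType G S U v ↔ ∃ x, (x ∈ S ∧ x ∉ U) ∧ Step G v x ∧ trace G U x = s := by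
  simp [cliqueType, and_assoc]

/-- Adjacency is transitive outside `U`, that is, the vertices outside `U` form disjoint
cliques. -/
def CliquesOff (G : SimpleGraph V) (U : Finset V) : Prop :=
  ∀ u v w, u ∉ U → v ∉ U → w ∉ U → Step G u v → Step G v w → Step G u w

theorem CliquesOff.eq_of_trace_subset (hU : CliquesOff G U) (hk : 2 ≤ k)
    (hS : ∀ a b, ¬ Reducible k G S a b) {v w : V} (hv : v ∈ S) (hvU : v ∉ U) (hw : w ∈ S)
    (hwU : w ∉ U) (hvw : Step G v w) (h : trace G U v ⊆ trace G U w) : v = w := by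
  refine Corner.eq hk hS hv hw fun x hx hvx => ?_
  by_cases hxU : x ∈ U
  · rcases hvx with rfl | hvx
    · exact absurd hxU hvU
    · exact Or.inr (mem_trace.1 (h (mem_trace.2 ⟨hxU, hvx⟩))).2
  · exact hU _ _ _ hwU hvU hxU hvw.symm hvx

/-- The traces on one clique form an antichain. -/
theorem CliquesOff.antichain (hU : CliquesOff G U) (hk : 2 ≤ k)
    (hS : ∀ a b, ¬ Reducible k G S a b) {v : V} (hvU : v ∉ U) {s t : Finset V}
    (hs : s ∈ cliqueType G S U v) (ht : t ∈ cliqueType G S U v) (hst : s ⊆ t) : s = t := by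
  obtain ⟨x, ⟨hx, hxU⟩, hvx, rfl⟩ := mem_cliqueType.1 hs
  obtain ⟨y, ⟨hy, hyU⟩, hvy, rfl⟩ := mem_cliqueType.1 ht
  rw [hU.eq_of_trace_subset hk hS hx hxU hy hyU (hU _ _ _ hxU hvU hyU hvx.symm hvy) hst]

/-- A vertex outside `U` is determined by its trace and the type of its clique, because of two
cliques of the same type one can be folded onto the other. -/
theorem CliquesOff.eq_of_type_eq (hU : CliquesOff G U) (hk : 2 ≤ k)
    (hS : ∀ a b, ¬ Reducible k G S a b) {a b : V} (ha : a ∈ S) (haU : a ∉ U) (hb : b ∈ S)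
    (hbU : b ∉ U) (htype : cliqueType G S U a = cliqueType G S U b)
    (htrace : trace G U a = trace G U b) : a = b := by
  by_cases hab : Step G a b
  · exact hU.eq_of_trace_subset hk hS ha haU hb hbU hab htrace.subset
  have hU' : ∀ {x y w}, trace G U x = trace G U y → w ∈ U → G.Adj x w → G.Adj y w :=
    fun h hw hx => (mem_trace.1 (h ▸ mem_trace.2 ⟨hw, hx⟩)).2
  refine Foldable.eq hk hS ha hb ⟨fun x hx hp => ?_, Or.inr fun x _ hx y _ hy => ?_⟩
  · have hxU : x ∉ U := fun hxU => hp.2 (Or.inr (hU' htrace hxU hp.1))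
    have : trace G U x ∈ cliqueType G S U b :=
      htype ▸ mem_cliqueType.2 ⟨x, ⟨hx, hxU⟩, Or.inr hp.1, rfl⟩
    obtain ⟨y, ⟨hy, hyU⟩, hby, hxy⟩ := mem_cliqueType.1 this
    refine ⟨y, hy, ⟨hby, fun hay => hab (hU _ _ _ haU hyU hbU hay hby.symm)⟩,
      fun w hw hxw hwd => ?_⟩
    by_cases hwU : w ∈ U
    · exact Or.inr (hU' hxy.symm hwU hxw)
    · exfalso
      rcases hU _ _ _ haU hxU hwU (Or.inr hp.1) (Or.inr hxw) with h | h
      · exact hwd (Or.inl h)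
      · exact hwd (Or.inr ⟨h, fun hbw => hab (hU _ _ _ haU hwU hbU (Or.inr h) hbw.symm)⟩)
  · have img : ∀ {x}, Img G a b x → x ∉ U := by
      rintro x ⟨h | h, hx⟩ hxU
      · exact hbU (h ▸ hxU)
      · exact hx (Or.inr (hU' htrace.symm hxU h))
    exact hU _ _ _ (img hx) hbU (img hy) hx.1.symm hy.1

theorem card_le_card_inter_add [DecidableEq V] (S U : Finset V) :
    S.card ≤ U.card + (S.filter fun x => x ∉ U).card := by
  have h1 := Finset.card_filter_add_card_filter_not (s := S) (fun x => x ∈ U)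
  have h2 : (S.filter fun x => x ∈ U).card ≤ U.card :=
    Finset.card_le_card fun x hx => (Finset.mem_filter.1 hx).2
  omega

theorem add_mul_three_pow_le (t m : ℕ) (hm : 1 ≤ m) (htm : t ≤ m) :
    t + 3 ^ m * m ≤ 2 * 4 ^ m := by
  have key : ∀ m, m + 3 ^ (m + 1) * (m + 1) + 1 ≤ 2 * 4 ^ (m + 1) := by
    intro m
    induction m using Nat.strong_induction_on with
    | _ m ih =>
      rcases m with _ | _ | _ | m
      · norm_num
      · norm_num
      · norm_num
      · have := ih (m + 2) (by omega)
        rw [pow_succ 3 (m + 3), pow_succ 4 (m + 3)]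
        have e3 : (3 : ℕ) ^ (m + 2 + 1) = 3 ^ (m + 3) := rfl
        have e4 : (4 : ℕ) ^ (m + 2 + 1) = 4 ^ (m + 3) := rfl
        rw [e3, e4] at this
        have : 0 < 3 ^ (m + 3) := by positivity
        nlinarith
  obtain ⟨m, rfl⟩ := Nat.exists_eq_add_of_le' hm
  have := key m
  omega

/-- The kernel bound for cliques.  Fix `x ∈ U`.  An antichain of subsets of `U` contains at most
one of the sets `P`, `insert x P` for each `P ⊆ U \ {x}`; so there are at most `3 ^ m` antichains,
with `m = 2 ^ (|U| - 1)`, and in a given antichain a member `s` is determined by `s \ {x}`. -/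
theorem CliquesOff.card_le (hU : CliquesOff G U) (hk : 2 ≤ k)
    (hS : ∀ a b, ¬ Reducible k G S a b) (hne : U.Nonempty) : S.card ≤ 2 * 2 ^ 2 ^ U.card := by
  classical
  obtain ⟨x, hx⟩ := hne
  let P := (U.erase x).powerset
  let g : V → P → Fin 3 := fun v p =>
    if p.1 ∈ cliqueType G S U v then 1 else if insert x p.1 ∈ cliqueType G S U v then 2 else 0
  have hP : ∀ v, (trace G U v).erase x ∈ P := fun v =>
    Finset.mem_powerset.2 (Finset.erase_subset_erase _ (trace_subset v))
  let e : V → (P → Fin 3) × P := fun v => (g v, ⟨_, hP v⟩)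
  have hinj : Set.InjOn e (S.filter fun x => x ∉ U) := by
    intro v hv w hw hvw
    obtain ⟨hv, hvU⟩ := Finset.mem_filter.1 (Finset.mem_coe.1 hv)
    obtain ⟨hw, hwU⟩ := Finset.mem_filter.1 (Finset.mem_coe.1 hw)
    obtain ⟨hg, htr⟩ := Prod.ext_iff.1 hvw
    have htr : (trace G U v).erase x = (trace G U w).erase x := congrArg Subtype.val htr
    have sub : ∀ {v w}, v ∉ U → g v = g w → cliqueType G S U v ⊆ cliqueType G S U w := by
      intro v w hvU hg s hs
      have hsU : s ⊆ U := by
        obtain ⟨y, -, -, rfl⟩ := mem_cliqueType.1 hs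
        exact trace_subset y
      by_cases hxs : x ∈ s
      · have hnot : s.erase x ∉ cliqueType G S U v := fun h => by
          have := hU.antichain hk hS hvU h hs (Finset.erase_subset _ _)
          exact Finset.notMem_erase x s (this.symm ▸ hxs)
        have := congrFun hg ⟨s.erase x, Finset.mem_powerset.2 (Finset.erase_subset_erase _ hsU)⟩
        simp only [g, Finset.insert_erase hxs, if_neg hnot, if_pos hs] at this
        split_ifs at this <;> first | assumption | simp at this
      · have := congrFun hg ⟨s, Finset.mem_powerset.2 (Finset.subset_erase.2 ⟨hsU, hxs⟩)⟩
        simp only [g, if_pos hs] at this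
        split_ifs at this <;> first | assumption | simp at this
    have htype : cliqueType G S U v = cliqueType G S U w :=
      (sub hvU hg).antisymm (sub hwU hg.symm)
    refine hU.eq_of_type_eq hk hS hv hvU hw hwU htype ?_
    have hvt : trace G U v ∈ cliqueType G S U v :=
      mem_cliqueType.2 ⟨v, ⟨hv, hvU⟩, Step.refl G v, rfl⟩
    have hwt : trace G U w ∈ cliqueType G S U v :=
      htype ▸ mem_cliqueType.2 ⟨w, ⟨hw, hwU⟩, Step.refl G w, rfl⟩
    by_cases hxw : x ∈ trace G U w
    · refine hU.antichain hk hS hvU hvt hwt fun y hy => ?_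
      by_cases hyx : y = x
      · rwa [hyx]
      · exact Finset.mem_of_mem_erase (htr ▸ Finset.mem_erase.2 ⟨hyx, hy⟩)
    · refine (hU.antichain hk hS hvU hwt hvt fun y hy => ?_).symm
      have hyx : y ≠ x := fun h => hxw (h ▸ hy)
      exact Finset.mem_of_mem_erase (htr.symm ▸ Finset.mem_erase.2 ⟨hyx, hy⟩)
  have hcard := Finset.card_le_card_of_injOn e (fun v _ => Finset.mem_univ (e v)) hinj
  have hPc : P.card = 2 ^ (U.card - 1) := by
    rw [Finset.card_powerset, Finset.card_erase_of_mem hx]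
  simp only [Finset.card_univ, Fintype.card_prod, Fintype.card_fun, Fintype.card_fin,
    Fintype.card_coe, hPc] at hcard
  have hpos : 1 ≤ U.card := Finset.card_pos.2 ⟨x, hx⟩
  have h4 : 2 ^ 2 ^ U.card = 4 ^ 2 ^ (U.card - 1) := by
    rw [show (4 : ℕ) = 2 ^ 2 by norm_num, ← pow_mul, ← pow_succ', Nat.sub_add_cancel hpos]
  have hle : U.card ≤ 2 ^ (U.card - 1) := by
    have := Nat.lt_pow_self (n := U.card - 1) (a := 2) (by norm_num)
    omega
  have := add_mul_three_pow_le U.card _ Nat.one_le_two_pow hle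
  have := card_le_card_inter_add S U
  omega

theorem CliquesOff.card_le_one (hU : CliquesOff G ∅) (hk : 2 ≤ k)
    (hS : ∀ a b, ¬ Reducible k G S a b) : S.card ≤ 1 := by
  have htr : ∀ v, trace G ∅ v = ∅ := fun v => by simp [trace]
  have htype : ∀ v ∈ S, cliqueType G S ∅ v = {∅} := by
    intro v hv
    ext s
    rw [mem_cliqueType, Finset.mem_singleton]
    constructor
    · rintro ⟨x, -, -, rfl⟩; exact htr x
    · rintro rfl; exact ⟨v, ⟨hv, Finset.notMem_empty v⟩, Step.refl G v, htr v⟩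
  refine Finset.card_le_one.2 fun a ha b hb => ?_
  exact hU.eq_of_type_eq hk hS ha (Finset.notMem_empty a) hb (Finset.notMem_empty b)
    (by rw [htype a ha, htype b hb]) (by rw [htr, htr])

theorem IsClusterGraph.cliquesOff (h : IsClusterGraph (deleteSet G U)) : CliquesOff G U := by
  intro u v w hu hv hw huv hvw
  rcases huv with rfl | huv
  · exact hvw
  rcases hvw with rfl | hvw
  · exact Or.inr huv
  by_cases huw : w = u
  · exact Or.inl huw
  have h1 : (deleteSet G U).Adj ⟨v, hv⟩ ⟨u, hu⟩ := huv.symm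
  have h2 : (deleteSet G U).Adj ⟨v, hv⟩ ⟨w, hw⟩ := hvw
  have := h ((deleteSet G U).connectedComponentMk ⟨v, hv⟩) (x := ⟨u, hu⟩) (y := ⟨w, hw⟩)
    (SimpleGraph.ConnectedComponent.eq.2 h1.reachable.symm)
    (SimpleGraph.ConnectedComponent.eq.2 h2.reachable.symm)
    (fun h => huw (congrArg Subtype.val h).symm)
  exact Or.inr this

end Cluster

/-! ### Irreducible graphs near star forests -/

section Stars

variable {V : Type*} {G : SimpleGraph V} {S U : Finset V} {k : ℕ}

/-- `z` assigns to the vertices of `T` the centres of disjoint stars, and these stars are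
the graph induced on `T`. -/
structure StarsOn (G : SimpleGraph V) (T : Finset V) (z : V → V) : Prop where
  mem : ∀ v ∈ T, z v ∈ T
  idem : ∀ v ∈ T, z (z v) = z v
  adj_iff : ∀ u ∈ T, ∀ v ∈ T, (G.Adj u v ↔ u ≠ v ∧ z u = z v ∧ (u = z u ∨ v = z v))

open Classical in
/-- The set of traces of the leaves of the star with centre `c`. -/
noncomputable def starType (G : SimpleGraph V) (T U : Finset V) (z : V → V) (c : V) :
    Finset (Finset V) :=
  (T.filter fun x => z x = c ∧ x ≠ c).image (trace G U)

theorem mem_starType {T : Finset V} {z : V → V} {c : V} {s : Finset V} :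
    s ∈ starType G T U z c ↔ ∃ x, x ∈ T ∧ (z x = c ∧ x ≠ c) ∧ trace G U x = s := by
  simp [starType, and_assoc]

variable {T : Finset V} {z : V → V}

theorem StarsOn.adj_center (hT : StarsOn G T z) {x : V} (hx : x ∈ T) (hxz : x ≠ z x) :
    G.Adj (z x) x :=
  (hT.adj_iff _ (hT.mem x hx) _ hx).2 ⟨hxz.symm, hT.idem x hx, Or.inl (hT.idem x hx).symm⟩

theorem StarsOn.eq_center (hT : StarsOn G T z) {x w : V} (hx : x ∈ T) (hxz : x ≠ z x)
    (hw : w ∈ T) (h : G.Adj x w) : w = z x := by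
  obtain ⟨-, h2, h3⟩ := (hT.adj_iff _ hx _ hw).1 h
  rw [h2]
  exact h3.resolve_left hxz

/-- Leaves see something in `U`, for otherwise they are dominated by their centres. -/
theorem StarsOn.trace_nonempty (hT : StarsOn G T z) (hTS : ∀ x, x ∈ T ↔ x ∈ S ∧ x ∉ U)
    (hk : 2 ≤ k) (hS : ∀ a b, ¬ Reducible k G S a b) {x : V} (hx : x ∈ T) (hxz : x ≠ z x) :
    trace G U x ≠ ∅ := by
  intro h
  refine hxz (Corner.eq hk hS ((hTS x).1 hx).1 ((hTS _).1 (hT.mem x hx)).1 fun w hw hxw => ?_)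
  rcases hxw with rfl | hxw
  · exact Or.inr (hT.adj_center hx hxz)
  · by_cases hwU : w ∈ U
    · exact absurd (mem_trace.2 ⟨hwU, hxw⟩) (h ▸ Finset.notMem_empty w)
    · exact Or.inl (hT.eq_center hx hxz ((hTS w).2 ⟨hw, hwU⟩) hxw)

/-- Leaves of the same star have different traces: twins can be folded onto each other. -/
theorem StarsOn.leaf_eq (hT : StarsOn G T z) (hTS : ∀ x, x ∈ T ↔ x ∈ S ∧ x ∉ U)
    (hk : 2 ≤ k) (hS : ∀ a b, ¬ Reducible k G S a b) {x y : V} (hx : x ∈ T) (hy : y ∈ T)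
    (hxz : x ≠ z x) (hyz : y ≠ z y) (hz : z x = z y) (h : trace G U x = trace G U y) : x = y := by
  have hp : ∀ w ∈ S, ¬ Priv G x y w := by
    rintro w hw ⟨hxw, hyw⟩
    refine hyw (Or.inr ?_)
    by_cases hwU : w ∈ U
    · exact (mem_trace.1 (h ▸ mem_trace.2 ⟨hwU, hxw⟩)).2
    · rw [hT.eq_center hx hxz ((hTS w).2 ⟨hw, hwU⟩) hxw, hz]
      exact (hT.adj_center hy hyz).symm
  exact Foldable.eq hk hS ((hTS x).1 hx).1 ((hTS y).1 hy).1
    ⟨fun w hw h => absurd h (hp w hw), Or.inl fun w hw h => absurd h (hp w hw)⟩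

/-- Centres with the same trace and the same set of traces of their leaves are equal: otherwise one
of their stars can be folded onto the other. -/
theorem StarsOn.center_eq (hT : StarsOn G T z) (hTS : ∀ x, x ∈ T ↔ x ∈ S ∧ x ∉ U)
    (hk : 2 ≤ k) (hS : ∀ a b, ¬ Reducible k G S a b) {a b : V} (ha : a ∈ T) (hb : b ∈ T)
    (haz : z a = a) (htype : starType G T U z a = starType G T U z b)
    (htrace : trace G U a = trace G U b) : a = b := by
  by_contra hab
  -- The private neighbours of `a` are the leaves of its star.
  have leaf : ∀ {x}, x ∈ S → Priv G a b x → x ∈ T ∧ z x = a ∧ x ≠ a := by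
    rintro x hx ⟨hax, hbx⟩
    have hxU : x ∉ U := fun hxU =>
      hbx (Or.inr (mem_trace.1 (htrace ▸ mem_trace.2 ⟨hxU, hax⟩)).2)
    have hxT := (hTS x).2 ⟨hx, hxU⟩
    obtain ⟨h1, h2, -⟩ := (hT.adj_iff _ ha _ hxT).1 hax
    exact ⟨hxT, by rw [← h2, haz], h1.symm⟩
  refine hab (Foldable.eq hk hS ((hTS a).1 ha).1 ((hTS b).1 hb).1
    ⟨fun x hx hp => ?_, Or.inl fun x hx hpx y hy hpy hxy => ?_⟩)
  · obtain ⟨hxT, hxa, hne⟩ := leaf hx hp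
    have : trace G U x ∈ starType G T U z b :=
      htype ▸ mem_starType.2 ⟨x, hxT, ⟨hxa, hne⟩, rfl⟩
    obtain ⟨y, hyT, ⟨hyb, hyne⟩, hxy⟩ := mem_starType.1 this
    have hby : G.Adj b y := hyb ▸ hT.adj_center hyT (by rwa [hyb])
    refine ⟨y, ((hTS y).1 hyT).1, ⟨Or.inr hby, ?_⟩, fun w hw hxw hwd => ?_⟩
    · rintro (h | h)
      · exact hab (by rw [← haz, ← hyb, h])
      · exact hab (by rw [← haz, ← hyb, ((hT.adj_iff _ ha _ hyT).1 h).2.1])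
    · by_cases hwU : w ∈ U
      · exact Or.inr (mem_trace.1 (hxy.symm ▸ mem_trace.2 ⟨hwU, hxw⟩)).2
      · have := hT.eq_center hxT (by rwa [hxa]) ((hTS w).2 ⟨hw, hwU⟩) hxw
        exact absurd (Or.inl (this.trans hxa)) hwd
  · obtain ⟨hxT, hxa, hne⟩ := leaf hx hpx
    obtain ⟨hyT, hya, hne'⟩ := leaf hy hpy
    exact hne' ((hT.eq_center hxT (by rwa [hxa]) hyT hxy).trans hxa)

/-- The kernel bound for stars.  A centre is determined by its trace and the set of traces
of its leaves, a family of nonempty subsets of `U`; a leaf is determined by the trace of its centre,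
its own trace, and the set of traces of the other leaves. -/
theorem StarsOn.card_le (hT : StarsOn G T z) (hTS : ∀ x, x ∈ T ↔ x ∈ S ∧ x ∉ U)
    (hk : 2 ≤ k) (hS : ∀ a b, ¬ Reducible k G S a b) :
    S.card ≤ U.card + 2 ^ U.card * 2 ^ (2 ^ U.card - 1) +
      2 ^ U.card * ((2 ^ U.card - 1) * 2 ^ (2 ^ U.card - 1 - 1)) := by
  classical
  let N := U.powerset.erase ∅
  have hN : N.card = 2 ^ U.card - 1 := by
    rw [Finset.card_erase_of_mem (Finset.empty_mem_powerset U), Finset.card_powerset]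
  have hTU : S.filter (fun x => x ∉ U) = T := by ext x; simp [hTS]
  have htN : ∀ x ∈ T, x ≠ z x → trace G U x ∈ N := fun x hx hxz =>
    Finset.mem_erase.2 ⟨hT.trace_nonempty hTS hk hS hx hxz,
      Finset.mem_powerset.2 (trace_subset x)⟩
  have htypeN : ∀ c, starType G T U z c ⊆ N := by
    intro c s hs
    obtain ⟨x, hx, ⟨hxc, hne⟩, rfl⟩ := mem_starType.1 hs
    exact htN x hx (by rwa [hxc])
  have hcenters : (T.filter fun x => x = z x).card ≤ 2 ^ U.card * 2 ^ (2 ^ U.card - 1) := by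
    have := Finset.card_le_card_of_injOn (s := T.filter fun x => x = z x)
      (t := U.powerset ×ˢ N.powerset) (fun x => (trace G U x, starType G T U z x))
      (fun x _ => Finset.mem_product.2 ⟨Finset.mem_powerset.2 (trace_subset x),
        Finset.mem_powerset.2 (htypeN x)⟩) ?_
    · rwa [Finset.card_product, Finset.card_powerset, Finset.card_powerset, hN] at this
    · intro x hx y hy hxy
      obtain ⟨hx, hxz⟩ := Finset.mem_filter.1 (Finset.mem_coe.1 hx)
      obtain ⟨hy, hyz⟩ := Finset.mem_filter.1 (Finset.mem_coe.1 hy)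
      obtain ⟨h1, h2⟩ := Prod.ext_iff.1 hxy
      exact hT.center_eq hTS hk hS hx hy hxz.symm h2 h1
  have hleaves : (T.filter fun x => ¬ x = z x).card ≤
      2 ^ U.card * ((2 ^ U.card - 1) * 2 ^ (2 ^ U.card - 1 - 1)) := by
    have := Finset.card_le_card_of_injOn (s := T.filter fun x => ¬ x = z x)
      (t := U.powerset ×ˢ N.sigma fun s => (N.erase s).powerset)
      (fun x => (trace G U (z x),
        ⟨trace G U x, (starType G T U z (z x)).erase (trace G U x)⟩)) ?_ ?_
    · have hs : ∀ s ∈ N, (N.erase s).powerset.card = 2 ^ (2 ^ U.card - 1 - 1) := fun s hs => by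
        rw [Finset.card_powerset, Finset.card_erase_of_mem hs, hN]
      rwa [Finset.card_product, Finset.card_powerset, Finset.card_sigma,
        Finset.sum_congr rfl hs, Finset.sum_const, hN, smul_eq_mul] at this
    · intro x hx
      obtain ⟨hx, hxz⟩ := Finset.mem_filter.1 (Finset.mem_coe.1 hx)
      exact Finset.mem_product.2 ⟨Finset.mem_powerset.2 (trace_subset _),
        Finset.mem_sigma.2 ⟨htN x hx hxz,
          Finset.mem_powerset.2 (Finset.erase_subset_erase _ (htypeN _))⟩⟩
    · intro x hx y hy hxy
      obtain ⟨hx, hxz⟩ := Finset.mem_filter.1 (Finset.mem_coe.1 hx)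
      obtain ⟨hy, hyz⟩ := Finset.mem_filter.1 (Finset.mem_coe.1 hy)
      obtain ⟨h1, h2⟩ := Prod.ext_iff.1 hxy
      obtain ⟨h2, h3⟩ := Sigma.mk.inj_iff.1 h2
      have h3 := eq_of_heq h3
      have hx' := mem_starType.2 ⟨x, hx, ⟨rfl, hxz⟩, (rfl : trace G U x = _)⟩
      have hy' := mem_starType.2 ⟨y, hy, ⟨rfl, hyz⟩, (rfl : trace G U y = _)⟩
      have htype : starType G T U z (z x) = starType G T U z (z y) := by
        rw [← Finset.insert_erase hx', ← Finset.insert_erase hy', h3, h2]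
      have hz : z x = z y := hT.center_eq hTS hk hS (hT.mem x hx) (hT.mem y hy)
        (hT.idem x hx) htype h1
      exact hT.leaf_eq hTS hk hS hx hy hxz hyz hz h2
  have h1 := Finset.card_filter_add_card_filter_not (s := T) (fun x => x = z x)
  have h2 := card_le_card_inter_add S U
  rw [hTU] at h2
  omega

theorem IsStarForest.exists_starsOn (h : IsStarForest (deleteSet G U)) {T : Finset V}
    (hT : ∀ v ∈ T, v ∉ U) : ∃ z, StarsOn G T z := by
  classical
  choose c hc hadj using h
  let H := deleteSet G U
  -- `w` is the centre in the whole graph.  If it is missing from `T`, its leaves become isolated.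
  let w : V → V := fun v => if hv : v ∉ U then (c (H.connectedComponentMk ⟨v, hv⟩)).1 else v
  let z : V → V := fun v => if w v ∈ T then w v else v
  have hw : ∀ v (hv : v ∉ U), w v = (c (H.connectedComponentMk ⟨v, hv⟩)).1 := fun v hv =>
    dif_pos hv
  have hwU : ∀ v (hv : v ∉ U), w v ∉ U := fun v hv => by
    rw [hw v hv]; exact (c _).2
  have hww : ∀ v (hv : v ∉ U), w (w v) = w v := by
    intro v hv
    have hcc := hc (H.connectedComponentMk ⟨v, hv⟩)
    rw [SimpleGraph.ConnectedComponent.mem_supp_iff] at hcc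
    have : (⟨w v, hwU v hv⟩ : {v // v ∉ U}) = c (H.connectedComponentMk ⟨v, hv⟩) :=
      Subtype.ext (hw v hv)
    rw [hw (w v) (hwU v hv), this]
    exact (congrArg (fun C => (c C).1) hcc).trans (hw v hv).symm
  have hwadj : ∀ u (hu : u ∉ U) v (hv : v ∉ U),
      G.Adj u v ↔ u ≠ v ∧ w u = w v ∧ (u = w u ∨ v = w v) := by
    intro u hu v hv
    have key : H.connectedComponentMk ⟨u, hu⟩ = H.connectedComponentMk ⟨v, hv⟩ →
        (G.Adj u v ↔ u ≠ v ∧ (u = w u ∨ v = w v)) := by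
      intro he
      have := hadj (H.connectedComponentMk ⟨u, hu⟩) ⟨u, hu⟩ rfl ⟨v, hv⟩ he.symm
      rw [hw u hu, hw v hv, ← he]
      simpa [Subtype.ext_iff] using this
    constructor
    · intro hGuv
      have hH : H.Adj ⟨u, hu⟩ ⟨v, hv⟩ := hGuv
      have he := SimpleGraph.ConnectedComponent.eq.2 hH.reachable
      have := (key he).1 hGuv
      exact ⟨this.1, by rw [hw u hu, hw v hv, he], this.2⟩
    · rintro ⟨h1, h2, h3⟩
      refine (key ?_).2 ⟨h1, h3⟩
      have e : ∀ C, H.connectedComponentMk (c C) = C := hc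
      rw [hw u hu, hw v hv] at h2
      rw [← e (H.connectedComponentMk ⟨u, hu⟩), ← e (H.connectedComponentMk ⟨v, hv⟩),
        Subtype.ext h2]
  have hz1 : ∀ v, w v ∈ T → z v = w v := fun v hv => if_pos hv
  have hz2 : ∀ v, w v ∉ T → z v = v := fun v hv => if_neg hv
  refine ⟨z, fun v hv => ?_, fun v hv => ?_, fun u hu v hv => ?_⟩
  · by_cases hwT : w v ∈ T
    · rwa [hz1 v hwT]
    · rwa [hz2 v hwT]
  · by_cases hwT : w v ∈ T
    · rw [hz1 v hwT, hz1 (w v) (by rwa [hww v (hT v hv)]), hww v (hT v hv)]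
    · rw [hz2 v hwT, hz2 v hwT]
  · rw [hwadj u (hT u hu) v (hT v hv)]
    by_cases hwu : w u ∈ T <;> by_cases hwv : w v ∈ T
    · rw [hz1 u hwu, hz1 v hwv]
    · rw [hz1 u hwu, hz2 v hwv]
      constructor
      · rintro ⟨-, h, -⟩; exact absurd (h ▸ hwu) hwv
      · rintro ⟨-, h, -⟩
        have := hww u (hT u hu)
        rw [h] at this
        exact absurd (this.symm ▸ hv) hwv
    · rw [hz2 u hwu, hz1 v hwv]
      constructor
      · rintro ⟨-, h, -⟩; exact absurd (h ▸ hwv) hwu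
      · rintro ⟨-, h, -⟩
        have := hww v (hT v hv)
        rw [← h] at this
        exact absurd (this.symm ▸ hu) hwu
    · rw [hz2 u hwu, hz2 v hwv]
      constructor
      · rintro ⟨-, h, h' | h'⟩
        · exact absurd (h' ▸ hu) hwu
        · exact absurd (h' ▸ hv) hwv
      · rintro ⟨h1, h2, -⟩; exact absurd h2 h1

end Stars

/-! ### Numerical bounds -/

section Bounds

theorem rpow_kernel_cvd {m t : ℕ} (h0 : t = 0 → m ≤ 1) (h1 : 1 ≤ t → m ≤ 2 * 2 ^ 2 ^ t) :
    (m : ℝ) ≤ (2 : ℝ) ^ ((2 : ℝ) ^ (t : ℝ) + Real.sqrt (t : ℝ)) := by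
  rcases Nat.eq_zero_or_pos t with rfl | ht
  · have := h0 rfl
    norm_num
    omega
  · have hm : (m : ℝ) ≤ 2 * 2 ^ 2 ^ t := by exact_mod_cast h1 ht
    have hs : (1 : ℝ) ≤ Real.sqrt t := Real.one_le_sqrt.2 (by exact_mod_cast ht)
    calc (m : ℝ) ≤ 2 * 2 ^ 2 ^ t := hm
      _ = (2 : ℝ) ^ ((2 : ℝ) ^ (t : ℝ) + 1) := by
        rw [Real.rpow_add_one (by norm_num), Real.rpow_natCast, mul_comm]
        congr 1
        rw [← Real.rpow_natCast]
        norm_num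
      _ ≤ _ := Real.rpow_le_rpow_of_exponent_le (by norm_num) (by linarith)

theorem star_count_le {t : ℕ} (ht : 4 ≤ t) :
    t + 2 ^ t * 2 ^ (2 ^ t - 1) + 2 ^ t * ((2 ^ t - 1) * 2 ^ (2 ^ t - 1 - 1)) ≤
      2 ^ (2 ^ t) * 2 ^ (2 * t) := by
  have ht' : t < 2 ^ t := Nat.lt_pow_self (by norm_num)
  obtain ⟨q, hq⟩ : ∃ q, 2 ^ t = q + 2 := Nat.exists_eq_add_of_le' (by omega)
  have h2 : 2 ^ (2 * t) = (q + 2) * (q + 2) := by rw [two_mul, pow_add, hq]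
  rw [h2, hq, show q + 2 - 1 = q + 1 by omega, show q + 1 - 1 = q by omega, pow_add 2 q 2,
    pow_succ 2 q]
  have h1 : 1 ≤ 2 ^ q := Nat.one_le_two_pow
  have h3 : t ≤ (q + 2) * 2 ^ q := by nlinarith
  nlinarith [Nat.zero_le (q * 2 ^ q), Nat.zero_le (q * q * 2 ^ q)]

theorem rpow_kernel_dts {m t : ℕ} (h : m ≤ t + 2 ^ t * 2 ^ (2 ^ t - 1) +
      2 ^ t * ((2 ^ t - 1) * 2 ^ (2 ^ t - 1 - 1))) :
    (m : ℝ) ≤ (2 : ℝ) ^ ((2 : ℝ) ^ (t : ℝ) + (t : ℝ) ^ (3 / 2 : ℝ)) := by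
  have hsq : ((t : ℝ) ^ (3 / 2 : ℝ)) ^ 2 = (t : ℝ) ^ 3 := by
    rw [← Real.rpow_natCast, ← Real.rpow_mul (by positivity), ← Real.rpow_natCast]
    norm_num
  have hnn : 0 ≤ (t : ℝ) ^ (3 / 2 : ℝ) := by positivity
  set x := (t : ℝ) ^ (3 / 2 : ℝ) with hx
  rw [Real.rpow_add (by norm_num)]
  have e : (2 : ℝ) ^ ((2 : ℝ) ^ (t : ℝ)) = ((2 ^ 2 ^ t : ℕ) : ℝ) := by
    rw [Real.rpow_natCast]
    push_cast
    rw [← Real.rpow_natCast 2 (2 ^ t)]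
    norm_num
  rw [e]
  -- An integer lower bound `d` on `2 * x = 2 * t ^ (3 / 2)` is enough: `4 * t` if `4 ≤ t`, and
  -- `0`, `2`, `5`, `10` for the smaller values of `t`.
  have two_rpow : ∀ d : ℕ, (d : ℝ) ^ 2 ≤ 4 * (t : ℝ) ^ 3 → (2 : ℝ) ^ d ≤ ((2 : ℝ) ^ x) ^ 2 := by
    intro d hd
    have hdx : (d : ℝ) ≤ x * 2 := by nlinarith
    have := Real.rpow_le_rpow_of_exponent_le (x := 2) (by norm_num) hdx
    rwa [Real.rpow_natCast, Real.rpow_mul (by norm_num),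
      show (2 : ℝ) = ((2 : ℕ) : ℝ) by norm_num, Real.rpow_natCast, Nat.cast_ofNat] at this
  have concl : ∀ d : ℕ, (d : ℝ) ^ 2 ≤ 4 * (t : ℝ) ^ 3 → m ^ 2 ≤ (2 ^ 2 ^ t) ^ 2 * 2 ^ d →
      (m : ℝ) ≤ ((2 ^ 2 ^ t : ℕ) : ℝ) * 2 ^ x := by
    intro d hd hm
    have hm' : (m : ℝ) ^ 2 ≤ ((2 ^ 2 ^ t : ℕ) : ℝ) ^ 2 * 2 ^ d := by exact_mod_cast hm
    refine le_of_sq_le_sq ?_ (by positivity)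
    rw [mul_pow]
    exact hm'.trans (mul_le_mul_of_nonneg_left (two_rpow d hd) (by positivity))
  by_cases ht : 4 ≤ t
  · refine concl (4 * t) ?_ ?_
    · have : (4 : ℝ) ≤ t := by exact_mod_cast ht
      push_cast
      nlinarith [sq_nonneg (t : ℝ)]
    · rw [show 4 * t = 2 * t * 2 by ring, pow_mul 2 (2 * t) 2, ← mul_pow]
      exact Nat.pow_le_pow_left (h.trans (star_count_le ht)) 2
  · interval_cases t
    · refine concl 0 (by norm_num) ?_
      norm_num at h ⊢
      nlinarith
    · refine concl 2 (by norm_num) ?_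
      norm_num at h ⊢
      nlinarith
    · refine concl 5 (by norm_num) ?_
      norm_num at h ⊢
      nlinarith
    · refine concl 10 (by norm_num) ?_
      norm_num at h ⊢
      nlinarith

end Bounds

/-! ### Total correctness of programs with a time bound -/

section ProgramLogic

/-- The state `s` with the variable `x` set to `v`. -/
def State.setVar (s : State) (x v : ℕ) : State := { s with var := Function.update s.var x v }

@[simp] theorem State.setVar_var (s : State) (x v : ℕ) :
    (s.setVar x v).var = Function.update s.var x v := rfl
@[simp] theorem State.setVar_arr (s : State) (x v : ℕ) : (s.setVar x v).arr = s.arr := rfl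
@[simp] theorem State.setVar_out (s : State) (x v : ℕ) : (s.setVar x v).out = s.out := rfl

/-- Started in `s`, the program `p` halts after at most `T` steps in a state with property `Q`. -/
def Exec (p : Prog) (s : State) (T : ℕ) (Q : State → Prop) : Prop :=
  ∃ s' t, Runs p s s' t ∧ t ≤ T ∧ Q s'

theorem Exec.mono {p : Prog} {s : State} {T T' : ℕ} {Q Q' : State → Prop} (h : Exec p s T Q)
    (hQ : ∀ s, Q s → Q' s) (hT : T ≤ T' := by rfl) : Exec p s T' Q' := by
  obtain ⟨s', t, hr, ht, hq⟩ := h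
  exact ⟨s', t, hr, ht.trans hT, hQ _ hq⟩

theorem Exec.skip {s : State} {Q : State → Prop} (h : Q s) : Exec .skip s 1 Q :=
  ⟨s, 1, .skip s, le_rfl, h⟩

theorem Exec.assign {s : State} {x : ℕ} {e : Expr} {Q : State → Prop}
    (h : Q (s.setVar x (e.eval s))) : Exec (.assign x e) s (e.cost + 1) Q :=
  ⟨_, _, .assign s x e, le_rfl, h⟩

theorem Exec.store {s : State} {a : ℕ} {i e : Expr} {Q : State → Prop}
    (h : Q { s with arr := Function.update s.arr a
                          (Function.update (s.arr a) (i.eval s) (e.eval s)) }) :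
    Exec (.store a i e) s (i.cost + e.cost + 1) Q :=
  ⟨_, _, .store s a i e, le_rfl, h⟩

theorem Exec.emit {s : State} {e : Expr} {Q : State → Prop}
    (h : Q { s with out := s.out ++ [decide (e.eval s ≠ 0)] }) :
    Exec (.emit e) s (e.cost + 1) Q :=
  ⟨_, _, .emit s e, le_rfl, h⟩

theorem Exec.seq {p q : Prog} {s : State} {T T' : ℕ} {Q : State → Prop}
    (h : Exec p s T fun s' => Exec q s' T' Q) : Exec (.seq p q) s (T + T' + 1) Q := by
  obtain ⟨s', t, hr, ht, s'', t', hr', ht', hq⟩ := h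
  exact ⟨s'', _, .seq hr hr', by omega, hq⟩

theorem Exec.ite {e : Expr} {p q : Prog} {s : State} {T : ℕ} {Q : State → Prop}
    (hp : e.eval s ≠ 0 → Exec p s T Q) (hq : e.eval s = 0 → Exec q s T Q) :
    Exec (.ite e p q) s (e.cost + T + 1) Q := by
  by_cases he : e.eval s = 0
  · obtain ⟨s', t, hr, ht, h⟩ := hq he
    exact ⟨s', _, .ite_false he hr, by omega, h⟩
  · obtain ⟨s', t, hr, ht, h⟩ := hp he
    exact ⟨s', _, .ite_true he hr, by omega, h⟩

theorem Exec.weaken_time {p : Prog} {s : State} {T T' : ℕ} {Q : State → Prop}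
    (h : Exec p s T Q) (hT : T ≤ T') : Exec p s T' Q := h.mono (fun _ h => h) hT

/-- Loops with an invariant `I j`, where `j` bounds the number of remaining rounds. -/
theorem Exec.loop {e : Expr} {p : Prog} {T : ℕ} (I : ℕ → State → Prop)
    (h : ∀ j s, I j s → e.eval s ≠ 0 → ∃ i, i + 1 ≤ j ∧ Exec p s T (I i))
    (j : ℕ) (s : State) (hs : I j s) :
    Exec (.loop e p) s (j * (e.cost + T + 1) + e.cost + 1)
      (fun s' => e.eval s' = 0 ∧ ∃ i, I i s') := by
  induction j using Nat.strong_induction_on generalizing s with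
  | _ j ih =>
    by_cases he : e.eval s = 0
    · exact ⟨s, _, .loop_done he, by omega, he, j, hs⟩
    · obtain ⟨i, hi, s', t, hr, ht, hI⟩ := h j s hs he
      obtain ⟨s'', t', hr', ht', hq⟩ := ih i hi s' hI
      refine ⟨s'', _, .loop_again he hr hr', ?_, hq⟩
      have := Nat.mul_le_mul_right (e.cost + T + 1) hi
      rw [add_mul] at this
      omega

/-- The loop in which variable `x` runs through the numbers below the value of variable `1`. -/
def forLoop (x : ℕ) (p : Prog) : Prog :=
  .seq (.assign x (.const 0))
    (.loop (.sub (.var 1) (.var x)) (.seq p (.assign x (.add (.var x) (.const 1)))))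

theorem Exec.forLoop {x : ℕ} {p : Prog} {T L N : ℕ} (hNL : N ≤ L)
    (I : ℕ → State → Prop) (hN : ∀ j s, I j s → s.var 1 = N)
    (h : ∀ j, j < N → ∀ s, I j s → s.var x = j →
      Exec p s T (fun s' => s'.var x = j ∧ I (j + 1) (s'.setVar x (j + 1))))
    (s : State) (hs : I 0 (s.setVar x 0)) :
    Exec (CnR.forLoop x p) s (L * (T + 9) + 7) (I N) := by
  refine Exec.weaken_time (T := 2 + (N * (3 + (T + 4 + 1) + 1) + 3 + 1) + 1) ?_ ?_
  · refine Exec.seq (Exec.assign ?_)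
    refine (Exec.loop (fun i s => ∃ j, i + j = N ∧ s.var x = j ∧ I j s) (T := T + 4 + 1)
      ?_ N _ ⟨0, rfl, by simp, hs⟩).mono ?_ ?_
    · rintro i s ⟨j, hij, hxj, hI⟩ he
      have hN' := hN j s hI
      simp only [Expr.eval, hN', hxj] at he
      refine ⟨i - 1, by omega, Exec.seq ((h j (by omega) s hI hxj).mono ?_)⟩
      rintro s' ⟨hx', hI'⟩
      refine Exec.assign ⟨j + 1, by omega, ?_, ?_⟩
      · simp [Expr.eval, hx']
      · simpa only [Expr.eval, hx'] using hI'
    · rintro s' ⟨he, i, j, hij, hxj, hI⟩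
      have hN' := hN j s' hI
      simp only [Expr.eval, hN', hxj] at he
      obtain rfl : j = N := by omega
      exact hI
    · simp [Expr.cost]
  · have := Nat.mul_le_mul_right (T + 9) hNL
    have e : N * (3 + (T + 4 + 1) + 1) = N * (T + 9) := by ring
    omega

/-- `s` and `s'` differ at most in the variables from `m` on. -/
structure Agree (m : ℕ) (s s' : State) : Prop where
  var : ∀ x < m, s'.var x = s.var x
  arr : s'.arr = s.arr
  out : s'.out = s.out

theorem Agree.refl (m : ℕ) (s : State) : Agree m s s := ⟨fun _ _ => rfl, rfl, rfl⟩

theorem Agree.trans {m : ℕ} {s s' s'' : State} (h : Agree m s s') (h' : Agree m s' s'') :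
    Agree m s s'' :=
  ⟨fun x hx => (h'.var x hx).trans (h.var x hx), h'.arr.trans h.arr, h'.out.trans h.out⟩

theorem Agree.of_le {m m' : ℕ} (hm : m ≤ m') {s s' : State} (h : Agree m' s s') : Agree m s s' :=
  ⟨fun x hx => h.var x (hx.trans_le hm), h.arr, h.out⟩

theorem Agree.setVar {m x : ℕ} (hx : m ≤ x) (s : State) (v : ℕ) : Agree m s (s.setVar x v) :=
  ⟨fun y hy => by simp [Function.update_of_ne (hy.trans_le hx).ne], rfl, rfl⟩

theorem Agree.setVar_setVar {m : ℕ} {s s' : State} (h : Agree m s s') (v : ℕ) :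
    Agree (m + 1) (s.setVar m v) (s'.setVar m v) := by
  refine ⟨fun x hx => ?_, h.arr, h.out⟩
  by_cases hxm : x = m
  · simp [hxm]
  · simpa [hxm] using h.var x (by omega)

end ProgramLogic

/-! ### Deciding first-order formulas -/

section Formulas

/-- All variables of the expression are smaller than `m`. -/
def Expr.Below (m : ℕ) : Expr → Prop
  | .const _ => True
  | .var x => x < m
  | .cell _ e => e.Below m
  | .add e₁ e₂ => e₁.Below m ∧ e₂.Below m
  | .sub e₁ e₂ => e₁.Below m ∧ e₂.Below m

theorem Expr.eval_agree {m : ℕ} {s s' : State} (h : Agree m s s') (e : Expr) (he : e.Below m) :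
    e.eval s' = e.eval s := by
  induction e with
  | const => rfl
  | var x => exact h.var x he
  | cell a e ih => simp only [Expr.eval, ih he, h.arr]
  | add e₁ e₂ ih₁ ih₂ => simp only [Expr.eval, ih₁ he.1, ih₂ he.2]
  | sub e₁ e₂ ih₁ ih₂ => simp only [Expr.eval, ih₁ he.1, ih₂ he.2]

/-- First-order formulas about a state, with quantifiers over the numbers below the value of
variable `1`.  Bound variables are de Bruijn levels: a quantifier at level `m` binds the program
variable `m`. -/
inductive Fm : Type
  | test (e : Expr)
  | neg (φ : Fm)
  | and (φ ψ : Fm)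
  | all (φ : Fm)

/-- The truth value of a formula that stands at level `m`. -/
def Fm.Holds : Fm → ℕ → State → Prop
  | .test e, _, s => e.eval s ≠ 0
  | .neg φ, m, s => ¬ φ.Holds m s
  | .and φ ψ, m, s => φ.Holds m s ∧ ψ.Holds m s
  | .all φ, m, s => ∀ i < s.var 1, φ.Holds (m + 1) (s.setVar m i)

/-- The formula, standing at level `m`, has no free variables from `m` on. -/
def Fm.Wf : Fm → ℕ → Prop
  | .test e, m => e.Below m
  | .neg φ, m => φ.Wf m
  | .and φ ψ, m => φ.Wf m ∧ ψ.Wf m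
  | .all φ, m => φ.Wf (m + 1)

/-- A program that decides the formula at level `m`.  It leaves the truth value in variable `m` and
uses the variables from `m` on as its work space. -/
def Fm.prog : Fm → ℕ → Prog
  | .test e, m => .ite e (.assign m (.const 1)) (.assign m (.const 0))
  | .neg φ, m => .seq (φ.prog m) (.assign m (.sub (.const 1) (.var m)))
  | .and φ ψ, m => .seq (φ.prog m) (.ite (.var m) (ψ.prog m) .skip)
  | .all φ, m =>
    .seq (.assign m (.const 0)) (.seq (.assign (m + 1) (.const 1)) (.seq
      -- The loop condition is the minimum of `var 1 - var m` and `var (m + 1)`.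
      (.loop (.sub (.sub (.var 1) (.var m)) (.sub (.sub (.var 1) (.var m)) (.var (m + 1))))
        (.seq (φ.prog (m + 1)) (.assign m (.add (.var m) (.const 1)))))
      (.assign m (.var (m + 1)))))

open Polynomial in
/-- A bound on the running time of `Fm.prog`, in terms of a bound on the value of variable `1`. -/
noncomputable def Fm.time : Fm → Polynomial ℕ
  | .test e => C (e.cost + 3)
  | .neg φ => φ.time + 5
  | .and φ ψ => φ.time + ψ.time + 4
  | .all φ => X * (φ.time + 15) + 19

theorem Fm.holds_agree {φ : Fm} {m : ℕ} (hm : 1 < m) (hφ : φ.Wf m) {s s' : State}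
    (h : Agree m s s') : φ.Holds m s' ↔ φ.Holds m s := by
  induction φ generalizing m s s' with
  | test e => simp only [Fm.Holds, Expr.eval_agree h e hφ]
  | neg φ ih => exact not_congr (ih hm hφ h)
  | and φ ψ ih₁ ih₂ => exact and_congr (ih₁ hm hφ.1 h) (ih₂ hm hφ.2 h)
  | all φ ih =>
    simp only [Fm.Holds, h.var 1 hm]
    exact forall₂_congr fun i _ => ih (by omega) hφ (h.setVar_setVar i)

open Classical in
/-- Every formula is decided in polynomial time. -/
theorem Fm.exec {L : ℕ} (φ : Fm) {m : ℕ} (hm : 1 < m) (hφ : φ.Wf m) {s : State}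
    (hL : s.var 1 ≤ L) :
    Exec (φ.prog m) s (φ.time.eval L)
      (fun s' => Agree m s s' ∧ s'.var m = if φ.Holds m s then 1 else 0) := by
  induction φ generalizing m s with
  | test e =>
    refine Exec.weaken_time (T := e.cost + 2 + 1) ?_ (by simp [Fm.time])
    refine Exec.ite (fun he => Exec.assign ⟨Agree.setVar le_rfl _ _, ?_⟩)
      fun he => Exec.assign ⟨Agree.setVar le_rfl _ _, ?_⟩
    · simp [Fm.Holds, Expr.eval, he]
    · simp [Fm.Holds, Expr.eval, he]
  | neg φ ih =>
    refine (Exec.seq (T' := 4) ((ih hm hφ hL).mono ?_)).weaken_time (by simp [Fm.time])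
    rintro s' ⟨ha, hv⟩
    refine Exec.assign ⟨ha.trans (Agree.setVar le_rfl _ _), ?_⟩
    by_cases h : φ.Holds m s <;> simp [Fm.Holds, Expr.eval, hv, h]
  | and φ ψ ih₁ ih₂ =>
    refine (Exec.seq (T' := 1 + (ψ.time.eval L + 1) + 1) ((ih₁ hm hφ.1 hL).mono ?_)).weaken_time
      (by simp [Fm.time]; omega)
    rintro s' ⟨ha, hv⟩
    refine Exec.ite (fun he => ?_) fun he => ?_
    · refine (ih₂ hm hφ.2 (by rwa [ha.var 1 hm])).mono ?_ (by omega)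
      rintro s'' ⟨ha', hv'⟩
      have h : φ.Holds m s := by
        by_contra h
        simp [Expr.eval, hv, h] at he
      refine ⟨ha.trans ha', ?_⟩
      simp only [hv', Fm.Holds, h, true_and, Fm.holds_agree hm hφ.2 ha]
    · refine (Exec.skip (Q := fun s'' => Agree m s s'' ∧ s''.var m =
        if (Fm.and φ ψ).Holds m s then 1 else 0) ⟨ha, ?_⟩).weaken_time (by omega)
      have h : ¬ φ.Holds m s := by
        intro h
        simp [Expr.eval, hv, h] at he
      simp [hv, Fm.Holds, h]
  | all φ ih =>
    have hm' : 1 ≠ m := by omega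
    have hm'' : 1 ≠ m + 1 := by omega
    let P : ℕ → Prop := fun i => φ.Holds (m + 1) (s.setVar m i)
    let I : ℕ → State → Prop := fun i s' => Agree m s s' ∧ ∃ j, i + j = s.var 1 ∧ s'.var m = j ∧
      s'.var (m + 1) = if ∀ l < j, P l then 1 else 0
    refine Exec.weaken_time (T := 2 + (2 + ((L * (9 + (φ.time.eval L + 4 + 1) + 1) + 9 + 1) + 2
      + 1) + 1) + 1) ?_ (by simp [Fm.time]; ring_nf; omega)
    refine Exec.seq (Exec.assign (Exec.seq (Exec.assign (Exec.seq
      (T := L * (9 + (φ.time.eval L + 4 + 1) + 1) + 9 + 1) (T' := 2) ?_))))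
    refine (Exec.loop I (T := φ.time.eval L + 4 + 1) ?_ (s.var 1) _ ⟨?_, 0, ?_⟩).mono ?_ ?_
    · rintro i s' ⟨ha, j, hij, hj, hr⟩ he
      have h1 : s'.var 1 = s.var 1 := ha.var 1 hm
      have hall : ∀ l < j, P l := by
        by_contra h
        simp only [Expr.eval, hr, if_neg h] at he
        omega
      simp only [Expr.eval, h1, hj, hr, if_pos hall] at he
      refine ⟨i - 1, by omega, Exec.seq ((ih (s := s') (by omega) hφ (by rwa [h1])).mono ?_)⟩
      rintro s'' ⟨ha', hv⟩
      have hm1 : s''.var m = j := by rw [ha'.var m (by omega), hj]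
      have hP : φ.Holds (m + 1) s' ↔ P j := by
        refine Fm.holds_agree (φ := φ) (by omega) hφ ⟨fun x hx => ?_, ha.arr, ha.out⟩
        by_cases hxm : x = m
        · simp [hxm, hj]
        · simpa [hxm] using ha.var x (by omega)
      refine Exec.assign ⟨(ha.trans (ha'.of_le (by omega))).trans (Agree.setVar le_rfl _ _),
        j + 1, by omega, by simp [Expr.eval, hm1], ?_⟩
      have : (∀ l < j + 1, P l) ↔ P j :=
        ⟨fun h => h j (by omega), fun h l hl => (Nat.lt_succ_iff_lt_or_eq.1 hl).elim (hall l)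
          fun e => e ▸ h⟩
      rw [State.setVar_var, Function.update_of_ne (by omega), hv]
      exact if_congr (hP.trans this.symm) rfl rfl
    · exact (Agree.setVar le_rfl _ _).trans (Agree.setVar (by omega) _ _)
    · simp [Expr.eval]
    · rintro s' ⟨he, i, ha, j, hij, hj, hr⟩
      have h1 : s'.var 1 = s.var 1 := ha.var 1 hm
      refine Exec.assign (Q := fun s'' => Agree m s s'' ∧ s''.var m =
        if (Fm.all φ).Holds m s then 1 else 0) ⟨ha.trans (Agree.setVar le_rfl _ _), ?_⟩
      simp only [State.setVar_var, Function.update_self, Expr.eval, hr]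
      refine if_congr (Iff.intro (fun h => ?_) fun h l hl => h l (by omega)) rfl rfl
      simp only [Expr.eval, h1, hj, hr, if_pos h] at he
      exact fun l hl => h l (by omega)
    · have := Nat.mul_le_mul_right (9 + (φ.time.eval L + 4 + 1) + 1) hL
      change s.var 1 * (9 + (φ.time.eval L + 4 + 1) + 1) + 9 + 1 ≤ _
      omega

end Formulas

/-! ### The reduction rule as a formula -/

section ReductionFormula

/-- Adjacency, read off the arrays: row `u` of the adjacency matrix starts at position
`A 1 u` of array `0`. -/
def AdjN (A : ℕ → ℕ → ℕ) (u v : ℕ) : Prop := A 0 (A 1 u + v) ≠ 0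

/-- Equality or adjacency, read off the arrays. -/
def StepN (A : ℕ → ℕ → ℕ) (u v : ℕ) : Prop :=
  A 0 (A 1 u + v) + (1 - ((u - v) + (v - u))) ≠ 0

namespace Fm

/-- Disjunction. -/
def or (φ ψ : Fm) : Fm := neg (and (neg φ) (neg ψ))

/-- Implication. -/
def imp (φ ψ : Fm) : Fm := neg (and φ (neg ψ))

/-- The vertex in variable `x` is alive. -/
def alive (x : ℕ) : Fm := test (.cell 2 (.var x))

/-- The vertices in variables `x` and `y` are adjacent. -/
def adj (x y : ℕ) : Fm := test (.cell 0 (.add (.cell 1 (.var x)) (.var y)))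

/-- The vertices in variables `x` and `y` are different. -/
def ne (x y : ℕ) : Fm := test (.add (.sub (.var x) (.var y)) (.sub (.var y) (.var x)))

/-- The vertices in variables `x` and `y` are equal or adjacent. -/
def step (x y : ℕ) : Fm :=
  test (.add (.cell 0 (.add (.cell 1 (.var x)) (.var y)))
    (.sub (.const 1) (.add (.sub (.var x) (.var y)) (.sub (.var y) (.var x)))))

/-- Universal quantification over the vertices that are alive, at level `m`. -/
def allAlive (m : ℕ) (φ : Fm) : Fm := all (imp (alive m) φ)

/-- The formula for `Priv`. -/
def priv (a b x : ℕ) : Fm := and (adj a x) (neg (step b x))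

/-- The formula for `Img`. -/
def img (a b x : ℕ) : Fm := and (step b x) (neg (step a x))

/-- The formula for `Del`. -/
def del (a b x : ℕ) : Fm := or (neg (ne x a)) (priv a b x)

/-- The formula for `Corner`, with `a`, `b` in variables `5`, `6`. -/
def corner : Fm := allAlive 12 (imp (step 5 12) (step 6 12))

/-- The formula for `Foldable`, with `a`, `b` in variables `5`, `6`. -/
def foldable : Fm :=
  and (allAlive 12 (imp (priv 5 6 12) (neg (allAlive 13 (neg (and (img 5 6 13)
      (allAlive 14 (imp (adj 12 14) (imp (neg (del 5 6 14)) (step 13 14))))))))))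
    (or (allAlive 12 (imp (priv 5 6 12) (allAlive 13 (imp (priv 5 6 13) (neg (adj 12 13))))))
      (allAlive 12 (imp (img 5 6 12) (allAlive 13 (imp (img 5 6 13) (step 12 13))))))

/-- The formula for `Reducible`, with `a`, `b` in variables `5`, `6` and the number of cops in
variable `3`. -/
def reducible : Fm :=
  and (alive 5) (and (alive 6) (and (ne 5 6)
    (or (and (neg (test (.sub (.var 3) (.const 1)))) corner)
      (and (test (.sub (.var 3) (.const 1))) foldable))))

variable {m : ℕ} {s : State}

theorem holds_or {φ ψ : Fm} : (or φ ψ).Holds m s ↔ φ.Holds m s ∨ ψ.Holds m s := by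
  simp only [or, Holds]; tauto

theorem holds_imp {φ ψ : Fm} : (imp φ ψ).Holds m s ↔ (φ.Holds m s → ψ.Holds m s) := by
  simp only [imp, Holds]; tauto

theorem holds_adj {x y : ℕ} : (adj x y).Holds m s ↔ AdjN s.arr (s.var x) (s.var y) := Iff.rfl

theorem holds_step {x y : ℕ} : (step x y).Holds m s ↔ StepN s.arr (s.var x) (s.var y) := Iff.rfl

theorem holds_alive {x : ℕ} : (alive x).Holds m s ↔ s.arr 2 (s.var x) ≠ 0 := Iff.rfl

theorem holds_ne {x y : ℕ} : (ne x y).Holds m s ↔ s.var x ≠ s.var y := by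
  simp only [ne, Holds, Expr.eval]; omega

theorem holds_allAlive {φ : Fm} : (allAlive m φ).Holds m s ↔
    ∀ i < s.var 1, s.arr 2 i ≠ 0 → φ.Holds (m + 1) (s.setVar m i) := by
  simp only [allAlive, Holds, holds_imp, holds_alive, State.setVar_var, State.setVar_arr,
    Function.update_self]

end Fm

/-- The state `s` represents the graph `G` with `k` cops, the set `S` of vertices that are alive,
and the output `o`. -/
structure Rep {n : ℕ} (G : SimpleGraph (Fin n)) (k : ℕ) (S : Finset (Fin n)) (o : List Bool)
    (s : State) : Prop where
  var_one : s.var 1 = n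
  var_three : s.var 3 = k
  adj : ∀ u v : Fin n, AdjN s.arr u v ↔ G.Adj u v
  alive : ∀ u : Fin n, s.arr 2 u ≠ 0 ↔ u ∈ S
  out : s.out = o

variable {n : ℕ} {G : SimpleGraph (Fin n)} {k : ℕ} {S : Finset (Fin n)} {o : List Bool}
  {s s' : State}

theorem Rep.agree {m : ℕ} (hm : 3 < m) (h : Rep G k S o s) (ha : Agree m s s') :
    Rep G k S o s' := by
  obtain ⟨h1, h2, h3, h4, h5⟩ := h
  refine ⟨?_, ?_, ?_, ?_, ?_⟩
  · rw [ha.var 1 (by omega), h1]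
  · rw [ha.var 3 hm, h2]
  · rwa [ha.arr]
  · rwa [ha.arr]
  · rw [ha.out, h5]

theorem Rep.setVar (h : Rep G k S o s) {x v : ℕ} (hx : 3 < x) : Rep G k S o (s.setVar x v) :=
  h.agree (m := 4) (by omega) (Agree.setVar (by omega) _ _)

theorem Rep.step (h : Rep G k S o s) (u v : Fin n) : StepN s.arr u v ↔ Step G u v := by
  have := h.adj u v
  rw [AdjN] at this
  rw [StepN, Step, ← this, Fin.ext_iff]
  omega

theorem forall_lt_iff_forall_fin {n : ℕ} {P : ℕ → Prop} :
    (∀ i < n, P i) ↔ ∀ i : Fin n, P i :=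
  ⟨fun h i => h i i.2, fun h i hi => h ⟨i, hi⟩⟩

/-- The formula `Fm.reducible` expresses `Reducible`. -/
theorem Rep.holds_reducible (h : Rep G k S o s) {a b : Fin n} (ha : s.var 5 = a)
    (hb : s.var 6 = b) : Fm.reducible.Holds 12 s ↔ Reducible k G S a b := by
  have hk : s.var 3 - 1 ≠ 0 ↔ ¬ k ≤ 1 := by rw [h.var_three]; omega
  have hc : Fm.corner.Holds 12 s ↔ Corner G S a b := by
    simp [Fm.corner, Corner, Fm.holds_allAlive, Fm.holds_imp, Fm.holds_step,
      h.var_one, forall_lt_iff_forall_fin, ha, hb, h.step, ← h.alive]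
  have hf : Fm.foldable.Holds 12 s ↔ Foldable G S a b := by
    simp [Fm.foldable, Foldable, Fm.holds_allAlive, Fm.holds_imp, Fm.holds_step, Fm.holds_adj,
      Fm.holds_or, Fm.holds_ne, Fm.Holds, Fm.priv, Fm.img, Fm.del, Priv, Img, Del,
      h.var_one, forall_lt_iff_forall_fin, ha, hb, h.step, h.adj, ← h.alive, Fin.ext_iff, and_assoc]
  simp only [Fm.reducible, Fm.Holds, Fm.holds_or, Fm.holds_alive, Fm.holds_ne, Expr.eval, hk, hc,
    hf, ha, hb, h.alive, Reducible]
  by_cases hk1 : k ≤ 1 <;> simp [hk1, Fin.ext_iff]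

theorem Rep.holds_del (h : Rep G k S o s) {a b x : Fin n} (ha : s.var 5 = a)
    (hb : s.var 6 = b) (hx : s.var 8 = x) : (Fm.del 5 6 8).Holds 12 s ↔ Del G a b x := by
  simp [Fm.holds_step, Fm.holds_adj, Fm.holds_or, Fm.holds_ne, Fm.Holds, Fm.priv, Fm.del, Priv,
    Del, ha, hb, hx, h.step, h.adj, Fin.ext_iff]

end ReductionFormula

/-! ### The program for the exhaustive reduction -/

section Sweeps

/-- Deletes the vertices to be folded, with `a`, `b` in variables `5`, `6`. -/
def foldProg : Prog :=
  forLoop 8 (.seq ((Fm.del 5 6 8).prog 12)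
    (.ite (.var 12) (.store 2 (.var 8) (.const 0)) .skip))

/-- Performs `attempt`, with `a`, `b` in variables `5`, `6`. -/
def attemptProg : Prog := .seq (Fm.reducible.prog 12) (.ite (.var 12) foldProg .skip)

/-- Computes `core`.  Variable `7` counts the sweeps, variables `5` and `6` run through the pairs, and
variables from `12` on are the work space of the formulas. -/
def coreProg : Prog := forLoop 7 (forLoop 5 (forLoop 6 attemptProg))

/-- A bound on the running time of `foldProg`. -/
noncomputable def foldTime (L : ℕ) : ℕ := L * (((Fm.del 5 6 8).time.eval L + 5 + 1) + 9) + 7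

/-- A bound on the running time of `attemptProg`. -/
noncomputable def attemptTime (L : ℕ) : ℕ := Fm.reducible.time.eval L + (foldTime L + 2) + 1

/-- A bound on the running time of `coreProg`. -/
noncomputable def coreTime (L : ℕ) : ℕ :=
  L * ((L * ((L * (attemptTime L + 9) + 7) + 9) + 7) + 9) + 7

variable {n : ℕ} {G : SimpleGraph (Fin n)} {k : ℕ} {S : Finset (Fin n)} {o : List Bool}
  {s : State} {L : ℕ}

open Classical in
theorem Rep.exec_fold (hL : n ≤ L) {a b : Fin n} (h : Rep G k S o s) (ha : s.var 5 = a)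
    (hb : s.var 6 = b) : Exec foldProg s (foldTime L) (fun s' => Rep G k (fold G S a b) o s' ∧
      s'.var 5 = a ∧ s'.var 6 = b ∧ s'.var 7 = s.var 7) := by
  let I : ℕ → State → Prop := fun j s' =>
    Rep G k (S.filter fun u => ¬ (u.1 < j ∧ Del G a b u)) o s' ∧
      s'.var 5 = a ∧ s'.var 6 = b ∧ s'.var 7 = s.var 7
  refine (Exec.forLoop hL I (fun j s h => h.1.var_one) ?_ s ?_).mono ?_
  · rintro j hj t ⟨hR, ha, hb, h7⟩ hx
    refine Exec.seq ((Fm.exec (L := L) _ (by norm_num)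
      (by simp [Fm.Wf, Fm.del, Fm.or, Fm.ne, Fm.priv, Fm.adj, Fm.step, Expr.Below])
      (hR.var_one.le.trans hL)).mono ?_)
    rintro t' ⟨hag, hv⟩
    have hR' := hR.agree (by norm_num) hag
    have hx' : t'.var 8 = j := by rw [hag.var 8 (by norm_num), hx]
    have rest : t'.var 5 = a ∧ t'.var 6 = b ∧ t'.var 7 = s.var 7 :=
      ⟨by rw [hag.var 5 (by norm_num), ha], by rw [hag.var 6 (by norm_num), hb],
        by rw [hag.var 7 (by norm_num), h7]⟩
    have hd := hR.holds_del ha hb (x := ⟨j, hj⟩) hx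
    rw [if_congr hd rfl rfl] at hv
    -- Only the entry of vertex `j` may change in round `j`.
    have hset : ∀ u : Fin n, u.1 ≠ j →
        (u ∈ S.filter (fun u => ¬ (u.1 < j + 1 ∧ Del G a b u)) ↔
          u ∈ S.filter fun u => ¬ (u.1 < j ∧ Del G a b u)) := by
      intro u hu
      have : u.1 < j + 1 ↔ u.1 < j := by omega
      simp only [Finset.mem_filter, this]
    refine Exec.ite (T := 3) (fun he => ?_) fun he => ?_
    · have hdel : Del G a b ⟨j, hj⟩ := by
        by_contra hdel
        simp [Expr.eval, hv, hdel] at he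
      refine Exec.store ⟨hx', ?_, ?_⟩
      · refine ⟨?_, ?_, ?_, fun u => ?_, ?_⟩
        · simpa using hR'.var_one
        · simpa using hR'.var_three
        · intro u v
          simpa [AdjN] using hR'.adj u v
        · by_cases hu : u.1 = j
          · obtain rfl : u = ⟨j, hj⟩ := Fin.ext hu
            simp [Expr.eval, hx', hdel]
          · rw [hset u hu, ← hR'.alive u]
            simp [Expr.eval, hx', hu]
        · simpa using hR'.out
      · simpa using rest
    · have hdel : ¬ Del G a b ⟨j, hj⟩ := by
        intro hdel
        simp [Expr.eval, hv, hdel] at he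
      refine (Exec.skip (Q := fun s' => s'.var 8 = j ∧ I (j + 1) (s'.setVar 8 (j + 1)))
        ⟨hx', ?_, by simpa using rest⟩).weaken_time (by norm_num)
      have : S.filter (fun u => ¬ (u.1 < j + 1 ∧ Del G a b u)) =
          S.filter fun u => ¬ (u.1 < j ∧ Del G a b u) := by
        ext u
        by_cases hu : u.1 = j
        · obtain rfl : u = ⟨j, hj⟩ := Fin.ext hu
          simp [hdel]
        · exact hset u hu
      rw [this]
      exact hR'.setVar (by norm_num)
  · refine ⟨?_, by simpa using ha, by simpa using hb, by simp⟩
    simpa using h.setVar (x := 8) (v := 0) (by norm_num)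
  · rintro s' ⟨hR, hrest⟩
    exact ⟨by simpa [fold] using hR, hrest⟩

theorem Rep.exec_attempt (hL : n ≤ L) {a b : Fin n} (h : Rep G k S o s) (ha : s.var 5 = a)
    (hb : s.var 6 = b) : Exec attemptProg s (attemptTime L) (fun s' =>
      Rep G k (attempt k G S a b) o s' ∧ s'.var 5 = a ∧ s'.var 6 = b ∧ s'.var 7 = s.var 7) := by
  refine Exec.seq (T := Fm.reducible.time.eval L) (T' := foldTime L + 2) ((Fm.exec _ (by norm_num)
    (by simp [Fm.Wf, Fm.del, Fm.or, Fm.ne, Fm.priv, Fm.adj, Fm.step, Expr.Below, Fm.reducible,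
      Fm.alive, Fm.corner, Fm.foldable, Fm.allAlive, Fm.imp, Fm.img])
    (h.var_one.le.trans hL)).mono ?_)
  rintro t ⟨hag, hv⟩
  have hR := h.agree (by norm_num) hag
  have rest : t.var 5 = a ∧ t.var 6 = b ∧ t.var 7 = s.var 7 :=
    ⟨by rw [hag.var 5 (by norm_num), ha], by rw [hag.var 6 (by norm_num), hb],
      hag.var 7 (by norm_num)⟩
  classical
  rw [if_congr (h.holds_reducible ha hb) rfl rfl] at hv
  refine (Exec.ite (T := foldTime L) (fun he => ?_) fun he => ?_).weaken_time
    (by simp [Expr.cost]; omega)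
  · have hr : Reducible k G S a b := by
      by_contra hr
      simp [Expr.eval, hv, hr] at he
    simpa [attempt, hr, rest] using hR.exec_fold hL rest.1 rest.2.1
  · have hr : ¬ Reducible k G S a b := by
      intro hr
      simp [Expr.eval, hv, hr] at he
    refine (Exec.skip ?_).weaken_time (T' := foldTime L) (by simp [foldTime])
    simpa [attempt, hr, rest] using hR

theorem take_finRange_succ {n j : ℕ} (hj : j < n) :
    (List.finRange n).take (j + 1) = (List.finRange n).take j ++ [⟨j, hj⟩] := by
  rw [List.take_add_one]
  simp [hj]

theorem take_finRange_self (n : ℕ) : (List.finRange n).take n = List.finRange n :=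
  List.take_of_length_le (by simp)

theorem Rep.exec_core (hL : n ≤ L) (h : Rep G k Finset.univ o s) :
    Exec coreProg s (coreTime L) (Rep G k (core k G) o) := by
  refine (Exec.forLoop hL (fun j s => Rep G k ((sweep k G)^[j] Finset.univ) o s)
    (fun j s h => h.var_one) ?_ s (h.setVar (by norm_num))).mono fun s h => h
  intro i hi s hs h7
  refine (Exec.forLoop hL (fun j s' => Rep G k (((List.finRange n).take j).foldl
      (fun S a => (List.finRange n).foldl (fun S b => attempt k G S a b) S)
      ((sweep k G)^[i] Finset.univ)) o s' ∧ s'.var 7 = i)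
    (fun j s h => h.1.var_one) ?_ s ⟨?_, ?_⟩).mono ?_
  · rintro j hj s ⟨hs, h7⟩ h5
    set S := ((List.finRange n).take j).foldl
      (fun S a => (List.finRange n).foldl (fun S b => attempt k G S a b) S)
      ((sweep k G)^[i] Finset.univ)
    refine (Exec.forLoop hL (fun l s' => Rep G k (((List.finRange n).take l).foldl
        (fun S b => attempt k G S ⟨j, hj⟩ b) S) o s' ∧ s'.var 5 = j ∧ s'.var 7 = i)
      (fun j s h => h.1.var_one) ?_ s ⟨?_, ?_⟩).mono ?_
    · rintro l hl s ⟨hs, h5, h7⟩ h6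
      refine (hs.exec_attempt hL (a := ⟨j, hj⟩) (b := ⟨l, hl⟩) h5 h6).mono ?_
      rintro s' ⟨hR, h5', h6', h7'⟩
      refine ⟨h6', ?_, by simpa using h5', by simpa [h7] using h7'⟩
      rw [take_finRange_succ hl, List.foldl_append]
      exact hR.setVar (by norm_num)
    · simpa using hs.setVar (by norm_num)
    · simp [h5, h7]
    · rintro s' ⟨hR, h5', h7'⟩
      refine ⟨h5', ?_, by simpa using h7'⟩
      rw [take_finRange_succ hj, List.foldl_append]
      rw [take_finRange_self] at hR
      exact hR.setVar (by norm_num)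
  · simpa using hs.setVar (by norm_num)
  · simpa using h7
  · rintro s' ⟨hR, h7'⟩
    refine ⟨h7', ?_⟩
    rw [Function.iterate_succ_apply']
    rw [take_finRange_self] at hR
    exact hR.setVar (by norm_num)

end Sweeps

/-! ### The encoding of instances -/

section Encoding

theorem getD_flatMap {α β : Type*} {f : α → List β} {n : ℕ} (hf : ∀ a, (f a).length = n)
    (l : List α) (d : β) {i j : ℕ} (hi : i < l.length) (hj : j < n) :
    (l.flatMap f).getD (i * n + j) d = (f l[i]).getD j d := by
  induction l generalizing i with
  | nil => simp at hi
  | cons a l ih =>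
    rw [List.flatMap_cons]
    cases i with
    | zero => simp [List.getElem?_append_left, hf, hj, List.getD_eq_getElem?_getD]
    | succ i =>
      rw [List.getD_append_right _ _ _ _ (by rw [hf]; nlinarith), hf,
        show (i + 1) * n + j - n = i * n + j by rw [add_mul]; omega, ih (by simpa using hi)]
      rfl

theorem length_flatMap_const {α β : Type*} {f : α → List β} {n : ℕ} (hf : ∀ a, (f a).length = n)
    (l : List α) : (l.flatMap f).length = l.length * n := by
  induction l with
  | nil => simp
  | cons a l ih => rw [List.flatMap_cons, List.length_append, ih, hf, List.length_cons]; ring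

/-- The number with the given binary digits, least significant first. -/
def ofBits (l : List Bool) : ℕ := l.foldr (fun b a => a + a + b.toNat) 0

theorem ofBits_bits (k : ℕ) : ofBits k.bits = k := by
  induction k using Nat.binaryRec' with
  | zero => rfl
  | bit b k hk ih =>
    rw [Nat.bits_append_bit k b hk, ofBits, List.foldr_cons, ← ofBits, ih]
    cases b <;> simp <;> omega

theorem ofBits_drop {l : List Bool} {i : ℕ} (hi : i < l.length) :
    ofBits (l.drop i) = ofBits (l.drop (i + 1)) + ofBits (l.drop (i + 1)) +
      (l.getD i false).toNat := by
  rw [List.getD_eq_getElem _ _ hi]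
  conv_lhs => rw [List.drop_eq_getElem_cons hi]
  rfl

theorem bits_eq_cons {q : ℕ} (hq : q ≠ 0) :
    q.bits = decide (q % 2 ≠ 0) :: (q / 2).bits := by
  have h := Nat.bit_bodd_div2 q
  have hb : q.bodd = decide (q % 2 ≠ 0) := by
    rw [Nat.mod_two_of_bodd]
    cases q.bodd <;> rfl
  rw [← Nat.div2_val, ← hb]
  conv_lhs => rw [← h]
  refine Nat.bits_append_bit _ _ fun h0 => ?_
  by_contra hbodd
  rw [h0, Bool.eq_false_of_not_eq_true hbodd] at h
  exact hq h.symm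

namespace Instance

variable (I : Instance)

/-- The position of the first bit of `k` in the encoding. -/
def bitsStart : ℕ := I.n + 1 + I.n * I.n

open Classical in
theorem length_row (u : Fin I.n) :
    ((List.finRange I.n).map fun v => decide (I.graph.Adj u v)).length = I.n := by simp

theorem length_encode : I.encode.length = I.bitsStart + I.k.bits.length := by
  classical
  rw [encode, List.length_append, List.length_append, List.length_append,
    length_flatMap_const I.length_row]
  simp [bitsStart]

theorem n_le_length_encode : I.n ≤ I.encode.length := by
  rw [length_encode, bitsStart]; omega

theorem encode_getD_unary {i : ℕ} (hi : i < I.n) : I.encode.getD i false = true := by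
  rw [encode, List.append_assoc, List.append_assoc, List.getD_append _ _ _ _ (by simpa using hi)]
  simp [List.getD_eq_getElem?_getD, hi]

theorem encode_getD_separator : I.encode.getD I.n false = false := by
  rw [encode, List.append_assoc, List.append_assoc, List.getD_append_right _ _ _ _ (by simp)]
  simp

open Classical in
theorem encode_getD_adj (u v : Fin I.n) :
    I.encode.getD (I.n + 1 + u * I.n + v) false = decide (I.graph.Adj u v) := by
  have hlt : u.1 * I.n + v.1 < I.n * I.n := by
    have := Nat.mul_le_mul_right I.n (show u.1 + 1 ≤ I.n from u.2)
    have := v.2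
    nlinarith
  rw [encode, List.getD_append _ _ _ _ (by
      rw [List.length_append, List.length_append, length_flatMap_const I.length_row]
      simp; omega),
    List.getD_append_right _ _ _ _ (by simp; omega)]
  rw [show I.n + 1 + u.1 * I.n + v.1 - (List.replicate I.n true ++ [false]).length =
      u.1 * I.n + v.1 by simp; omega,
    getD_flatMap I.length_row _ _ (by simp) v.2]
  simp

theorem encode_getD_bits (i : ℕ) :
    I.encode.getD (I.bitsStart + i) false = I.k.bits.getD i false := by
  classical
  have hlen : (List.replicate I.n true ++ [false] ++ (List.finRange I.n).flatMap
      (fun u => (List.finRange I.n).map (fun v => decide (I.graph.Adj u v)))).length =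
      I.bitsStart := by
    rw [List.length_append, List.length_append, length_flatMap_const I.length_row]
    simp [bitsStart]
  rw [encode, List.getD_append_right _ _ _ _ (by rw [hlen]; omega), hlen, Nat.add_sub_cancel_left]

end Instance

end Encoding

/-! ### The kernelization -/

section Kernel

variable {n : ℕ} {G : SimpleGraph (Fin n)} {k : ℕ} {S : Finset (Fin n)}

/-- The elements of `S` in increasing order. -/
def aliveList (S : Finset (Fin n)) : List (Fin n) := (List.finRange n).filter (· ∈ S)

theorem mem_aliveList {v : Fin n} : v ∈ aliveList S ↔ v ∈ S := by simp [aliveList]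

/-- The positions in `aliveList S` correspond to the elements of `S`. -/
def aliveEquiv (S : Finset (Fin n)) : Fin (aliveList S).length ≃ S :=
  (List.Nodup.getEquiv _ ((List.nodup_finRange n).filter _)).trans
    (Equiv.subtypeEquivRight fun _ => mem_aliveList)

theorem length_aliveList (S : Finset (Fin n)) : (aliveList S).length = S.card := by
  have := Fintype.card_congr (aliveEquiv S)
  simpa using this

/-- `G[S]`, with the vertices renumbered. -/
def relabel (G : SimpleGraph (Fin n)) (S : Finset (Fin n)) :
    SimpleGraph (Fin (aliveList S).length) :=
  G.comap (aliveList S).get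

theorem step_relabel_iff {x y : Fin (aliveList S).length} :
    Step (relabel G S) x y ↔ Step (sub G S) (aliveEquiv S x) (aliveEquiv S y) :=
  or_congr (aliveEquiv S).injective.eq_iff.symm Iff.rfl

theorem step_relabel_symm {x y : S} (h : Step (sub G S) x y) :
    Step (relabel G S) ((aliveEquiv S).symm x) ((aliveEquiv S).symm y) := by
  rw [step_relabel_iff]; simpa using h

theorem connected_relabel (h : (sub G S).Connected) : (relabel G S).Connected := by
  have := h.nonempty.map (aliveEquiv S).symm
  exact ⟨Preconnected.map_step (aliveEquiv S).symm.surjective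
    (fun _ _ => step_relabel_symm) h.preconnected⟩

theorem isCopwin_relabel : IsCopwin (relabel G S) k ↔ IsCopwin (sub G S) k :=
  ⟨IsCopwin.map_retraction (aliveEquiv S).apply_symm_apply (fun _ _ => step_relabel_symm)
      (fun _ _ => step_relabel_iff.1),
    IsCopwin.map_retraction (aliveEquiv S).symm_apply_apply (fun _ _ => step_relabel_iff.1)
      (fun _ _ => step_relabel_symm)⟩

/-- The kernelization.  With at most one cop the reduced graph decides the instance, and the
output is a single vertex with one cop or none. -/
noncomputable def kernel (I : Instance) : Instance :=
  if I.k ≤ 1 then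
    ⟨1, ⊥, SimpleGraph.connected_bot_iff.2 ⟨inferInstance, inferInstance⟩,
      I.k - ((core I.k I.graph).card - 1)⟩
  else
    ⟨(aliveList (core I.k I.graph)).length, relabel I.graph (core I.k I.graph),
      connected_relabel (core_spec I.connected).1,
      min I.k (core I.k I.graph).card⟩

theorem isCopwin_one_iff (hG : (sub G S).Connected)
    (hS : ∀ a b, ¬ Reducible 1 G S a b) : IsCopwin (sub G S) 1 ↔ S.card ≤ 1 := by
  have := hG.nonempty
  constructor
  · intro h
    by_contra hc
    have : Nontrivial S := by
      rw [← Fintype.one_lt_card_iff_nontrivial, Fintype.card_coe]; omega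
    refine not_isCopwin_one (fun a b hab => ?_) h
    by_contra hx
    push Not at hx
    refine hS a b ⟨a.2, b.2, fun h => hab (Subtype.ext h), ?_⟩
    rw [if_pos le_rfl]
    intro x hxS hax
    exact step_sub_iff.1 (hx ⟨x, hxS⟩ (step_sub_iff.2 hax))
  · intro h
    exact isCopwin_of_card_le (by rwa [Fintype.card_coe])

theorem kernel_isYes_iff (I : Instance) : (kernel I).IsYes ↔ I.IsYes := by
  have hcore := core_spec (k := I.k) I.connected
  have hne := hcore.1.nonempty
  unfold kernel
  split_ifs with hk
  · rw [Instance.IsYes, Instance.IsYes, ← hcore.2]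
    rcases Nat.le_one_iff_eq_zero_or_eq_one.1 hk with h0 | h1
    · have hz : ∀ j, j = 0 → ¬ IsCopwin (sub I.graph (core I.k I.graph)) j := by
        rintro _ rfl; exact not_isCopwin_zero
      rw [show I.k - ((core I.k I.graph).card - 1) = 0 by omega]
      exact iff_of_false not_isCopwin_zero (hz _ h0)
    · have hred := not_reducible_core (k := I.k) (G := I.graph)
      have hiff := isCopwin_one_iff (G := I.graph) (S := core I.k I.graph) hcore.1
        (by rw [h1] at hred ⊢; exact hred)
      have : IsCopwin (sub I.graph (core I.k I.graph)) I.k ↔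
          (core I.k I.graph).card ≤ 1 := by
        rw [← hiff, h1]
      rw [this]
      by_cases hc : (core I.k I.graph).card ≤ 1
      · rw [show I.k - ((core I.k I.graph).card - 1) = 1 by omega]
        exact iff_of_true (isCopwin_of_card_le (by simp)) hc
      · rw [show I.k - ((core I.k I.graph).card - 1) = 0 by omega]
        exact iff_of_false not_isCopwin_zero hc
  · rw [Instance.IsYes, Instance.IsYes, ← hcore.2]
    simp only [isCopwin_relabel]
    rcases le_total I.k (core I.k I.graph).card with h | h
    · rw [min_eq_left h]
    · exact iff_of_true (isCopwin_of_card_le (by rw [min_eq_right h, Fintype.card_coe]))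
        (isCopwin_of_card_le (by rwa [Fintype.card_coe]))

theorem kernel_k_le (I : Instance) : (kernel I).k ≤ (kernel I).n := by
  unfold kernel
  split_ifs with hk
  · simp only; omega
  · simp only [length_aliveList]; exact min_le_right _ _

/-- A bound on the size of irreducible graphs for at least two cops is a bound on the kernel. -/
theorem kernel_n_le {I : Instance} {b : ℝ} (hb : 1 ≤ b)
    (h : 2 ≤ I.k → ∀ S : Finset (Fin I.n), (∀ a c, ¬ Reducible I.k I.graph S a c) →
      (S.card : ℝ) ≤ b) : ((kernel I).n : ℝ) ≤ b := by
  unfold kernel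
  split_ifs with hk
  · simpa using hb
  · simp only [length_aliveList]
    exact h (by omega) _ fun a c => not_reducible_core a c

theorem exists_clusterDeletion {V : Type*} [Fintype V] (G : SimpleGraph V) :
    ∃ U : Finset V, U.card = cvd G ∧ IsClusterGraph (deleteSet G U) := by
  refine Nat.sInf_mem (s := {t | ∃ U : Finset V, U.card = t ∧ IsClusterGraph (deleteSet G U)})
    ⟨_, Finset.univ, rfl, fun C x _ => absurd (Finset.mem_univ x.1) x.2⟩

theorem exists_starDeletion {V : Type*} [Fintype V] (G : SimpleGraph V) :
    ∃ U : Finset V, U.card = dts G ∧ IsStarForest (deleteSet G U) := by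
  refine Nat.sInf_mem (s := {t | ∃ U : Finset V, U.card = t ∧ IsStarForest (deleteSet G U)})
    ⟨_, Finset.univ, rfl, fun C => ?_⟩
  obtain ⟨x, -⟩ := C.nonempty_supp
  exact absurd (Finset.mem_univ x.1) x.2

theorem kernel_n_le_cvd (I : Instance) : ((kernel I).n : ℝ) ≤
    (2 : ℝ) ^ ((2 : ℝ) ^ (cvd I.graph : ℝ) + Real.sqrt (cvd I.graph : ℝ)) := by
  refine kernel_n_le (Real.one_le_rpow (by norm_num) (by positivity)) fun hk S hS => ?_
  obtain ⟨U, hU, hcl⟩ := exists_clusterDeletion I.graph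
  have hcl := hcl.cliquesOff
  refine rpow_kernel_cvd (fun h0 => ?_) fun h1 => ?_
  · obtain rfl : U = ∅ := Finset.card_eq_zero.1 (hU.trans h0)
    exact hcl.card_le_one hk hS
  · rw [← hU] at h1 ⊢
    exact hcl.card_le hk hS (Finset.card_pos.1 h1)

theorem kernel_n_le_dts (I : Instance) : ((kernel I).n : ℝ) ≤
    (2 : ℝ) ^ ((2 : ℝ) ^ (dts I.graph : ℝ) + (dts I.graph : ℝ) ^ (3 / 2 : ℝ)) := by
  refine kernel_n_le (Real.one_le_rpow (by norm_num) (by positivity)) fun hk S hS => ?_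
  obtain ⟨U, hU, hst⟩ := exists_starDeletion I.graph
  obtain ⟨z, hz⟩ := hst.exists_starsOn (T := S \ U) fun v hv => (Finset.mem_sdiff.1 hv).2
  refine rpow_kernel_dts ?_
  rw [← hU]
  exact hz.card_le (fun x => Finset.mem_sdiff) hk hS

end Kernel

/-! ### Reading the input -/

section Parsing

/-- Reads the number of vertices into variable `1`. -/
def readN : Prog :=
  .loop (.cell 0 (.var 1)) (.assign 1 (.add (.var 1) (.const 1)))

/-- Stores the positions of the rows of the adjacency matrix in array `1`, marks all vertices
as alive in array `2`, and leaves the position of the first bit of `k` in variable `4`. -/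
def readRows : Prog :=
  .seq (.assign 4 (.add (.var 1) (.const 1)))
    (forLoop 5 (.seq (.store 1 (.var 5) (.var 4)) (.seq (.store 2 (.var 5) (.const 1))
      (.assign 4 (.add (.var 4) (.var 1))))))

/-- Reads the number of cops into variable `3`, most significant bit first. -/
def readK : Prog :=
  .seq (.assign 5 (.var 0))
    (.loop (.sub (.var 5) (.var 4)) (.seq (.assign 5 (.sub (.var 5) (.const 1)))
      (.assign 3 (.add (.add (.var 3) (.var 3)) (.cell 0 (.var 5))))))

/-- Sets up the representation of the input. -/
def readInput : Prog := .seq readN (.seq readRows readK)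

variable (I : Instance) {L : ℕ}

/-- What holds throughout the reading phase, in terms of the current values `n`, `k` of
variables `1`, `3`. -/
structure Reading (n k : ℕ) (s : State) : Prop where
  var_zero : s.var 0 = I.encode.length
  var_one : s.var 1 = n
  var_three : s.var 3 = k
  arr : ∀ i, s.arr 0 i = (I.encode.getD i false).toNat
  out : s.out = []

variable {I}

theorem Reading.setVar {n k : ℕ} {s : State} (h : Reading I n k s) {x v : ℕ} (hx : 3 < x) :
    Reading I n k (s.setVar x v) := by
  obtain ⟨h0, h1, h3, ha, ho⟩ := h
  have hx0 : 0 ≠ x := by omega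
  have hx1 : 1 ≠ x := by omega
  have hx3 : 3 ≠ x := by omega
  exact ⟨by simpa [hx0] using h0, by simpa [hx1] using h1, by simpa [hx3] using h3, ha, ho⟩

theorem exec_readN (hL : I.n ≤ L) :
    Exec readN (initState I.encode) (L * 7 + 3) (Reading I I.n 0) := by
  refine (Exec.loop (T := 4) (fun i s => ∃ j, i + j = I.n ∧ Reading I j 0 s) ?_ I.n _
    ⟨0, rfl, ⟨rfl, rfl, rfl, fun _ => rfl, rfl⟩⟩).mono ?_ ?_
  · rintro i s ⟨j, hij, h⟩ he
    have hne : i ≠ 0 := by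
      rintro rfl
      rw [zero_add] at hij
      subst hij
      simp only [Expr.eval, h.var_one, h.arr, I.encode_getD_separator] at he
      exact he rfl
    refine ⟨i - 1, by omega, Exec.assign ⟨j + 1, by omega, ?_⟩⟩
    exact ⟨by simpa using h.var_zero, by simp [Expr.eval, h.var_one],
      by simpa using h.var_three, h.arr, h.out⟩
  · rintro s ⟨he, i, j, hij, h⟩
    obtain rfl : j = I.n := by
      by_contra hj
      simp only [Expr.eval, h.var_one, h.arr,
        I.encode_getD_unary (i := j) (by omega)] at he
      exact absurd he (by decide)
    exact h
  · have := Nat.mul_le_mul_right 7 hL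
    change I.n * 7 + 2 + 1 ≤ _
    omega

/-- What holds after `j` rows have been handled. -/
structure Rows (I : Instance) (j : ℕ) (s : State) : Prop extends Reading I I.n 0 s where
  var_four : s.var 4 = I.n + 1 + j * I.n
  row : ∀ u < j, s.arr 1 u = I.n + 1 + u * I.n
  alive : ∀ u < j, s.arr 2 u = 1

theorem exec_readRows (hL : I.n ≤ L) {s : State} (h : Reading I I.n 0 s) :
    Exec readRows s (4 + (L * (12 + 9) + 7) + 1) (Rows I I.n) := by
  refine Exec.seq (Exec.assign ((Exec.forLoop (T := 12) hL (Rows I)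
    (fun j s h => h.toReading.var_one) ?_ _ ?_).mono fun s h => h))
  · intro j hj s hs h5
    refine Exec.seq (T := 3) (T' := 8) (Exec.store (Exec.seq (T := 3) (T' := 4)
      (Exec.store (Exec.assign ?_))))
    refine ⟨by simpa using h5, ?_⟩
    refine ⟨⟨?_, ?_, ?_, ?_, ?_⟩, ?_, ?_, ?_⟩
    · simpa using hs.var_zero
    · simpa using hs.var_one
    · simpa using hs.var_three
    · simpa using hs.arr
    · simpa using hs.out
    · simp [Expr.eval, hs.var_four, hs.var_one]; ring
    · intro u hu
      by_cases huj : u = j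
      · simp [Expr.eval, h5, huj, hs.var_four]
      · simpa [Expr.eval, h5, huj] using hs.row u (by omega)
    · intro u hu
      by_cases huj : u = j
      · simp [Expr.eval, h5, huj]
      · simpa [Expr.eval, h5, huj] using hs.alive u (by omega)
  · refine ⟨(h.setVar (by norm_num)).setVar (by norm_num), ?_, ?_, ?_⟩
    · simp [Expr.eval, h.var_one]
    · simp
    · simp

theorem exec_readK (hL : I.encode.length ≤ L) {s : State} (h : Rows I I.n s) :
    Exec readK s (2 + (L * 17 + 4) + 1) (Rep I.graph I.k Finset.univ []) := by
  let P : ℕ → State → Prop := fun i s => Reading I I.n (ofBits (I.k.bits.drop i)) s ∧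
    i ≤ I.k.bits.length ∧ s.var 4 = I.bitsStart ∧ s.var 5 = I.bitsStart + i ∧
    (∀ u < I.n, s.arr 1 u = I.n + 1 + u * I.n) ∧ ∀ u < I.n, s.arr 2 u = 1
  refine Exec.seq (Exec.assign ((Exec.loop (T := 12) P ?_ I.k.bits.length _ ?_).mono ?_ ?_))
  · rintro i s ⟨hR, hi, h4, h5, hrow, hal⟩ he
    simp only [Expr.eval, h4, h5] at he
    refine ⟨i - 1, by omega, Exec.seq (T := 4) (T' := 7) (Exec.assign (Exec.assign ?_))⟩
    have hlt : i - 1 < I.k.bits.length := by omega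
    have e1 : i - 1 + 1 = i := by omega
    have e2 : I.bitsStart + i - 1 = I.bitsStart + (i - 1) := by omega
    refine ⟨⟨?_, ?_, ?_, hR.arr, hR.out⟩, by omega, ?_, ?_, hrow, hal⟩
    · simpa using hR.var_zero
    · simpa using hR.var_one
    · rw [ofBits_drop hlt, e1]
      simp [Expr.eval, hR.var_three, h5, hR.arr, e2, I.encode_getD_bits,
        -List.getD_eq_getElem?_getD]
    · simpa using h4
    · simp [Expr.eval, h5, e2]
  · refine ⟨?_, le_rfl, ?_, ?_, h.row, h.alive⟩
    · simpa [ofBits] using h.toReading.setVar (x := 5) (by norm_num)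
    · simpa [Instance.bitsStart] using h.var_four
    · simp [Expr.eval, h.var_zero, I.length_encode]
  · rintro s ⟨he, i, hR, hi, h4, h5, hrow, hal⟩
    simp only [Expr.eval, h4, h5] at he
    obtain rfl : i = 0 := by omega
    refine ⟨hR.var_one, ?_, fun u v => ?_, fun u => ?_, hR.out⟩
    · rw [hR.var_three, List.drop_zero, ofBits_bits]
    · classical
      rw [AdjN, hrow u u.2, hR.arr, I.encode_getD_adj u v]
      by_cases hadj : I.graph.Adj u v <;> simp [hadj]
    · simp [hal u u.2]
  · have : I.k.bits.length ≤ L := by rw [I.length_encode] at hL; omega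
    have := Nat.mul_le_mul_right 17 this
    change I.k.bits.length * (3 + 12 + 1) + 3 + 1 ≤ _
    omega

/-- A bound on the running time of `readInput`. -/
def readTime (L : ℕ) : ℕ :=
  L * 7 + 3 + (4 + (L * (12 + 9) + 7) + 1 + (2 + (L * 17 + 4) + 1) + 1) + 1

theorem exec_readInput (hL : I.encode.length ≤ L) :
    Exec readInput (initState I.encode) (readTime L) (Rep I.graph I.k Finset.univ []) := by
  have hn := I.n_le_length_encode.trans hL
  exact Exec.seq ((exec_readN hn).mono fun s hs =>
    Exec.seq ((exec_readRows hn hs).mono fun s hs => exec_readK hL hs))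

end Parsing

/-! ### Writing the output -/

section Output

variable {n : ℕ} {G : SimpleGraph (Fin n)} {k : ℕ} {S : Finset (Fin n)} {o : List Bool}
  {s : State} {L : ℕ}

theorem flatMap_finRange_ite {β : Type*} (S : Finset (Fin n)) (f : Fin n → List β) :
    ((List.finRange n).flatMap fun u => if u ∈ S then f u else []) =
      (aliveList S).flatMap f := by
  rw [aliveList]
  generalize List.finRange n = l
  induction l with
  | nil => rfl
  | cons a l ih =>
    rw [List.flatMap_cons, ih, List.filter_cons]
    by_cases ha : a ∈ S <;> simp [ha]

/-- Loops over the vertices whose body writes the word `g u` for every vertex `u` that is alive. -/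
theorem Rep.exec_output {x T : ℕ} {p : Prog} (hL : n ≤ L) (hx : 3 < x)
    (g : Fin n → List Bool) (P : State → Prop) (hP : ∀ s v, P s → P (s.setVar x v))
    (hp : ∀ (u : Fin n) o s, u ∈ S → Rep G k S o s → P s → s.var x = u →
      Exec p s T fun s' => Rep G k S (o ++ g u) s' ∧ P s' ∧ s'.var x = u)
    (h : Rep G k S o s) (hPs : P s) :
    Exec (CnR.forLoop x (.ite (.cell 2 (.var x)) p .skip)) s (L * ((T + 4) + 9) + 7)
      (fun s' => Rep G k S (o ++ (aliveList S).flatMap g) s' ∧ P s') := by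
  refine (Exec.forLoop hL (fun j s' => Rep G k S (o ++ ((List.finRange n).take j).flatMap
    fun u => if u ∈ S then g u else []) s' ∧ P s') (fun j s h => h.1.var_one) ?_ s ?_).mono ?_
  · rintro j hj s ⟨hs, hPs⟩ hxj
    have hal := hs.alive ⟨j, hj⟩
    refine (Exec.ite (T := T + 1) (fun he => ?_) fun he => ?_).weaken_time
      (by simp [Expr.cost]; omega)
    · simp only [Expr.eval, hxj] at he
      refine (hp ⟨j, hj⟩ _ s (hal.1 he) hs hPs hxj).mono ?_ (by omega)
      rintro s' ⟨hR, hP', hx'⟩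
      refine ⟨hx', ?_, hP _ _ hP'⟩
      rw [take_finRange_succ hj]
      simpa [hal.1 he] using hR.setVar hx
    · simp only [Expr.eval, hxj] at he
      have hnot : (⟨j, hj⟩ : Fin n) ∉ S := fun h => hal.2 h he
      refine Exec.weaken_time (T := 1) (Exec.skip ⟨hxj, ?_, hP _ _ hPs⟩) (by omega)
      rw [take_finRange_succ hj]
      simpa [hnot] using hs.setVar hx
  · exact ⟨by simpa using h.setVar hx, hP _ _ hPs⟩
  · rintro s' ⟨hR, hP'⟩
    rw [take_finRange_self, flatMap_finRange_ite] at hR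
    exact ⟨hR, hP'⟩

theorem Rep.emit (h : Rep G k S o s) (b : Bool) :
    Rep G k S (o ++ [b]) { s with out := s.out ++ [b] } :=
  ⟨h.var_one, h.var_three, h.adj, h.alive, by simp [h.out]⟩

/-- Counts the vertices that are alive in variable `9`. -/
def countProg : Prog :=
  .seq (.assign 9 (.const 0)) (forLoop 8
    (.ite (.cell 2 (.var 8)) (.assign 9 (.add (.var 9) (.const 1))) .skip))

theorem Rep.exec_count (hL : n ≤ L) (h : Rep G k S o s) :
    Exec countProg s (2 + (L * (7 + 9) + 7) + 1)
      (fun s' => Rep G k S o s' ∧ s'.var 9 = S.card) := by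
  refine Exec.seq (Exec.assign ((Exec.forLoop hL (T := 7) (fun j s' => Rep G k S o s' ∧
    s'.var 9 = (((List.finRange n).take j).filter (· ∈ S)).length) (fun j s h => h.1.var_one)
    ?_ _ ?_).mono ?_))
  · rintro j hj s ⟨hs, h9⟩ hxj
    have hal := hs.alive ⟨j, hj⟩
    rw [take_finRange_succ hj, List.filter_append, List.length_append]
    refine Exec.ite (T := 4) (fun he => ?_) fun he => ?_
    · simp only [Expr.eval, hxj] at he
      refine Exec.assign ⟨by simpa using hxj, (hs.setVar (by norm_num)).setVar (by norm_num), ?_⟩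
      simp [Expr.eval, h9, hal.1 he]
    · simp only [Expr.eval, hxj] at he
      have hnot : (⟨j, hj⟩ : Fin n) ∉ S := fun h => hal.2 h he
      refine Exec.weaken_time (T := 1) (Exec.skip ⟨hxj, hs.setVar (by norm_num), ?_⟩)
        (by norm_num)
      simp [h9, hnot]
  · exact ⟨(h.setVar (by norm_num)).setVar (by norm_num), by simp [Expr.eval]⟩
  · rintro s' ⟨hR, h9⟩
    rw [take_finRange_self] at h9
    exact ⟨hR, h9.trans (length_aliveList S)⟩

/-- Writes the binary digits of variable `3`, which is halved by repeated subtraction. -/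
def bitsProg : Prog :=
  .loop (.var 3) (.seq (.assign 10 (.const 0)) (.seq
    (.loop (.sub (.var 3) (.const 1)) (.seq (.assign 3 (.sub (.var 3) (.const 2)))
      (.assign 10 (.add (.var 10) (.const 1)))))
    (.seq (.emit (.var 3)) (.assign 3 (.var 10)))))

/-- A bound on the running time of `bitsProg`. -/
def bitsTime (L : ℕ) : ℕ := L * (1 + (2 + ((L * 13 + 4) + 5 + 1) + 1) + 1) + 1 + 1

theorem exec_bits {q : ℕ} (hq : q ≤ L) (h : s.var 3 = q) :
    Exec bitsProg s (bitsTime L) (fun s' => s'.out = s.out ++ q.bits) := by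
  let P : ℕ → State → Prop := fun i s' => s'.var 3 ≤ i ∧ s'.var 3 ≤ L ∧
    s'.out ++ (s'.var 3).bits = s.out ++ q.bits
  refine (Exec.loop (T := 2 + ((L * 13 + 4) + 5 + 1) + 1) P ?_ q s
    ⟨h.le, h ▸ hq, by rw [h]⟩).mono ?_ ?_
  · rintro i t ⟨hi, hiL, ho⟩ he
    refine ⟨i - 1, ?_, Exec.seq (Exec.assign (Exec.seq (T := L * 13 + 4) (T' := 5) ?_))⟩
    · simp only [Expr.eval] at he
      omega
    refine (Exec.loop (T := 4 + 4 + 1) (fun j t' => t'.var 3 ≤ j ∧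
      t'.var 3 + 2 * t'.var 10 = t.var 3 ∧ t'.out = t.out) ?_ (t.var 3) _
      ?_).mono ?_ ?_
    · rintro j t' ⟨hj, hsum, ho'⟩ he'
      simp only [Expr.eval] at he'
      refine ⟨j - 1, by omega, Exec.seq (Exec.assign (Exec.assign ⟨?_, ?_, ho'⟩))⟩
      · simp [Expr.eval]; omega
      · simp [Expr.eval]; omega
    · exact ⟨by simp, by simp [Expr.eval], rfl⟩
    · rintro t' ⟨he', j, hj, hsum, ho'⟩
      simp only [Expr.eval] at he he'
      have h10 : t'.var 10 = t.var 3 / 2 := by omega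
      have h3 : t'.var 3 = t.var 3 % 2 := by omega
      refine Exec.seq (T := 2) (T' := 2) (Exec.emit (Exec.assign ⟨?_, ?_, ?_⟩))
      · simp [Expr.eval, h10]; omega
      · simp [Expr.eval, h10]; omega
      · rw [← ho, bits_eq_cons he]
        simp [Expr.eval, h10, h3, ho']
    · have := Nat.mul_le_mul_right 13 hiL
      change t.var 3 * (3 + 9 + 1) + 3 + 1 ≤ _
      omega
  · rintro s' ⟨he, i, hi, hiL, ho⟩
    simp only [Expr.eval] at he
    rw [← ho, he]
    simp
  · have := Nat.mul_le_mul_right (1 + (2 + ((L * 13 + 4) + 5 + 1) + 1) + 1) hq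
    unfold bitsTime
    change q * (1 + (2 + ((L * 13 + 4) + 5 + 1) + 1) + 1) + 1 + 1 ≤ _
    omega

/-- Writes the one-vertex graph with at most one cop. -/
def writeSmall : Prog :=
  .seq (.emit (.const 1)) (.seq (.emit (.const 0)) (.seq (.emit (.const 0))
    (.ite (.sub (.var 3) (.sub (.var 9) (.const 1))) (.emit (.const 1)) .skip)))

theorem exec_writeSmall (hk : k ≤ 1) (h : Rep G k S [] s) {c : ℕ} (h9 : s.var 9 = c) :
    Exec writeSmall s 20 (fun s' => s'.out = [true, false, false] ++ (k - (c - 1)).bits) := by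
  refine Exec.weaken_time (T := 2 + (2 + (2 + 8 + 1) + 1) + 1) ?_ (by norm_num)
  refine Exec.seq (T := 2) (Exec.emit (Exec.seq (T := 2) (T' := 2 + 8 + 1) (Exec.emit
    (Exec.seq (T := 2) (T' := 8) (Exec.emit ?_)))))
  refine Exec.ite (T := 2) (fun he => Exec.emit ?_) fun he =>
    Exec.weaken_time (T := 1) (Exec.skip ?_) (by norm_num)
  · simp only [Expr.eval, h.var_three, h9] at he
    have : k - (c - 1) = 1 := by omega
    simp [Expr.eval, h.out, this]
  · simp only [Expr.eval, h.var_three, h9] at he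
    simp [Expr.eval, h.out, he]

/-- Writes the number of vertices that are alive in unary. -/
def writeUnary : Prog := forLoop 5 (.ite (.cell 2 (.var 5)) (.emit (.const 1)) .skip)

/-- Writes the adjacency matrix of the vertices that are alive. -/
def writeMatrix : Prog :=
  forLoop 5 (.ite (.cell 2 (.var 5)) (forLoop 6 (.ite (.cell 2 (.var 6))
    (.emit (.cell 0 (.add (.cell 1 (.var 5)) (.var 6)))) .skip)) .skip)

/-- Writes the reduced graph. -/
def writeLarge : Prog :=
  .seq writeUnary (.seq (.emit (.const 0)) (.seq writeMatrix
    (.seq (.assign 3 (.sub (.var 3) (.sub (.var 3) (.var 9)))) bitsProg)))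

/-- A bound on the running time of `writeLarge`. -/
def writeTime (L : ℕ) : ℕ :=
  (L * ((2 + 4) + 9) + 7) + (2 + ((L * (((L * ((6 + 4) + 9) + 7) + 4) + 9) + 7) +
    (6 + bitsTime L + 1) + 1) + 1) + 1

open Classical in
theorem exec_writeLarge (hL : n ≤ L) (h : Rep G k S [] s) (h9 : s.var 9 = S.card) :
    Exec writeLarge s (writeTime L) (fun s' => s'.out =
      (aliveList S).map (fun _ => true) ++ [false] ++
        (aliveList S).flatMap (fun u => (aliveList S).map fun v => decide (G.Adj u v)) ++
        (min k S.card).bits) := by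
  have hcard : S.card ≤ L := (Finset.card_le_univ S).trans (by simpa using hL)
  refine Exec.seq ((h.exec_output hL (by norm_num) (T := 2) (fun _ => [true])
    (fun s => s.var 9 = S.card) (fun s v hs => by simpa using hs) ?_ h9).mono ?_)
  · intro u o s _ hs h9 h5
    exact Exec.emit ⟨hs.emit _, h9, h5⟩
  rintro s ⟨h, h9⟩
  refine Exec.seq (Exec.emit (Exec.seq (((h.emit _).exec_output hL (by norm_num)
    (fun u => (aliveList S).map fun v => decide (G.Adj u v))
    (fun s => s.var 9 = S.card) (fun s v hs => by simpa using hs) ?_ h9).mono ?_)))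
  · intro u o s _ hs h9 h5
    refine (hs.exec_output (T := 6) hL (by norm_num) (fun v => [decide (G.Adj u v)])
      (fun s => s.var 9 = S.card ∧ s.var 5 = u) (fun s v hs => by simpa using hs) ?_
      ⟨h9, h5⟩).mono ?_
    · rintro v o s _ hs ⟨h9, h5⟩ h6
      refine Exec.emit ⟨?_, ⟨h9, h5⟩, h6⟩
      have : decide (Expr.eval s (.cell 0 (.add (.cell 1 (.var 5)) (.var 6))) ≠ 0) =
          decide (G.Adj u v) := by
        refine decide_eq_decide.2 ?_
        rw [← hs.adj u v]
        simp [Expr.eval, AdjN, h5, h6]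
      rw [this]
      exact hs.emit _
    · rintro s' ⟨hs', h9', h5'⟩
      rw [← List.map_eq_flatMap] at hs'
      exact ⟨hs', h9', h5'⟩
  · rintro s ⟨h, h9⟩
    have hmin : s.var 3 - (s.var 3 - s.var 9) = min k S.card := by
      rw [h.var_three, h9]; omega
    refine Exec.seq (Exec.assign ((exec_bits (q := min k S.card)
      ((min_le_right _ _).trans hcard) (by simp [Expr.eval, hmin])).mono fun s' hs' => ?_))
    rw [hs', List.map_eq_flatMap]
    simp [h.out, Expr.eval]

/-- The kernelization as a program. -/
def kernelProg : Prog :=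
  .seq readInput (.seq coreProg (.seq countProg
    (.ite (.sub (.var 3) (.const 1)) writeLarge writeSmall)))

/-- A bound on the running time of `kernelProg`. -/
noncomputable def kernelTime (L : ℕ) : ℕ :=
  readTime L + (coreTime L + ((2 + (L * (7 + 9) + 7) + 1) + (3 + (writeTime L + 20) + 1) + 1)
    + 1) + 1

theorem flatMap_map_finRange_get {α β : Type*} (l : List α) (A : α → α → β) :
    ((List.finRange l.length).flatMap fun u => (List.finRange l.length).map fun v =>
      A (l.get u) (l.get v)) = l.flatMap fun u => l.map fun v => A u v := by
  have hmap : ∀ {γ : Type _} (g : α → γ),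
      ((List.finRange l.length).map fun v => g (l.get v)) = l.map g := fun g => by
    conv_rhs => rw [← List.map_get_finRange l, List.map_map]
    rfl
  rw [List.flatMap_def, List.flatMap_def, ← hmap]
  exact congrArg (fun f => (List.map f (List.finRange l.length)).flatten)
    (funext fun u => hmap (A (l.get u)))

theorem encode_kernel_of_le {I : Instance} (hk : I.k ≤ 1) : (kernel I).encode =
    [true, false, false] ++ (I.k - ((core I.k I.graph).card - 1)).bits := by
  rw [kernel, if_pos hk]
  simp [Instance.encode, show List.finRange 1 = [0] from rfl]

open Classical in
theorem encode_kernel_of_not_le {I : Instance} (hk : ¬ I.k ≤ 1) : (kernel I).encode =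
    (aliveList (core I.k I.graph)).map (fun _ => true) ++ [false] ++
      (aliveList (core I.k I.graph)).flatMap
        (fun u => (aliveList (core I.k I.graph)).map fun v => decide (I.graph.Adj u v)) ++
      (min I.k (core I.k I.graph).card).bits := by
  rw [kernel, if_neg hk, Instance.encode]
  rw [← flatMap_map_finRange_get (aliveList _) fun u v => decide (I.graph.Adj u v),
    List.map_const']
  rfl

theorem exec_kernelProg (I : Instance) (hL : I.encode.length ≤ L) :
    Exec kernelProg (initState I.encode) (kernelTime L)
      (fun s => s.out = (kernel I).encode) := by
  have hn := I.n_le_length_encode.trans hL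
  refine Exec.seq ((exec_readInput hL).mono fun s hs => Exec.seq ((hs.exec_core hn).mono
    fun s hs => Exec.seq ((hs.exec_count hn).mono ?_)))
  rintro s ⟨hs, h9⟩
  refine Exec.ite (fun he => ?_) fun he => ?_
  · simp only [Expr.eval, hs.var_three] at he
    rw [encode_kernel_of_not_le (by omega)]
    exact (exec_writeLarge hn hs h9).weaken_time (by omega)
  · simp only [Expr.eval, hs.var_three] at he
    rw [encode_kernel_of_le (by omega)]
    exact (exec_writeSmall (by omega) hs h9).weaken_time (by omega)

end Output

/-! ### Polynomial running time -/

section PolynomialTime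

/-- `f` is given by a polynomial. -/
def IsPoly (f : ℕ → ℕ) : Prop := ∃ P : Polynomial ℕ, ∀ L, P.eval L = f L

theorem IsPoly.const (c : ℕ) : IsPoly fun _ => c := ⟨.C c, by simp⟩

theorem IsPoly.id : IsPoly fun L => L := ⟨.X, by simp⟩

theorem IsPoly.eval (P : Polynomial ℕ) : IsPoly fun L => P.eval L := ⟨P, fun _ => rfl⟩

theorem IsPoly.add {f g : ℕ → ℕ} (hf : IsPoly f) (hg : IsPoly g) : IsPoly fun L => f L + g L := by
  obtain ⟨P, hP⟩ := hf
  obtain ⟨Q, hQ⟩ := hg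
  exact ⟨P + Q, by simp [hP, hQ]⟩

theorem IsPoly.mul {f g : ℕ → ℕ} (hf : IsPoly f) (hg : IsPoly g) : IsPoly fun L => f L * g L := by
  obtain ⟨P, hP⟩ := hf
  obtain ⟨Q, hQ⟩ := hg
  exact ⟨P * Q, by simp [hP, hQ]⟩

theorem isPoly_kernelTime : IsPoly kernelTime := by
  unfold kernelTime readTime coreTime attemptTime foldTime writeTime bitsTime
  repeat' first
    | exact IsPoly.const _
    | exact IsPoly.id
    | exact IsPoly.eval _
    | apply IsPoly.add
    | apply IsPoly.mul

theorem polyTimeComputable_kernel :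
    PolyTimeComputable Instance.encode Instance.encode kernel := by
  obtain ⟨T, hT⟩ := isPoly_kernelTime
  refine ⟨kernelProg, T, fun I => ?_⟩
  obtain ⟨s, t, hr, ht, ho⟩ := exec_kernelProg I le_rfl
  exact ⟨s, t, hr, by rwa [hT], ho⟩

end PolynomialTime

end CnR

theorem theorem5 :
    CnR.HasKernel (fun I => CnR.cvd I.graph)
        (fun t => (2 : ℝ) ^ ((2 : ℝ) ^ (t : ℝ) + Real.sqrt (t : ℝ))) ∧
      CnR.HasKernel (fun I => CnR.dts I.graph)
        (fun t => (2 : ℝ) ^ ((2 : ℝ) ^ (t : ℝ) + (t : ℝ) ^ (3 / 2 : ℝ))) :=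
  ⟨⟨CnR.kernel, CnR.polyTimeComputable_kernel, fun I =>
      ⟨CnR.kernel_isYes_iff I, CnR.kernel_n_le_cvd I, CnR.kernel_k_le I⟩⟩,
    ⟨CnR.kernel, CnR.polyTimeComputable_kernel, fun I =>
      ⟨CnR.kernel_isYes_iff I, CnR.kernel_n_le_dts I, CnR.kernel_k_le I⟩⟩⟩
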